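/- A \emph{polynomial knot} is a smooth embedding $\kappa:\mathbb{R}\to\mathbb{R}^3$ whose components are polynomials (so $\kappa$ is injective and $\kappa'(t)\neq 0$ for all $t$); its \emph{degree} is the maximum of the degrees of its components. A \emph{topological knot} is a continuous embedding of $S^1=\mathbb{R}\cup\{\infty\}$ in $S^3=\mathbb{R}^3\cup\{\infty\}$; two of them, $\alpha_0,\alpha_1$, have the same knot type if $\alpha_0=g\circ\alpha_1\circ f$ for orientation-preserving homeomorphisms $f$ of $S^1$ and $g$ of $S^3$. The \emph{superbridge number} of a topological knot $K$ is the minimum, over all knots $K'\subset\mathbb{R}^3$ of the same knot type as $K$, of the maximum, over all unit vectors $v\in\mathbb{R}^3$, of the number of local maxima of $K'$ in the direction $v$, i.e. of the function $x\mapsto\langle v,x\rangle$ on $K'$ (a connected plateau of local maximum points counts as one local maximum). The superbridge number of a polynomial knot $\kappa$ is that of its one-point compactification $\bar\kappa:S^1\to S^3$, $\bar\kappa(\infty)=\infty$. \textbf{Proposition.} If $\kappa$ is a polynomial knot of degree $d$ with superbridge number $s$, then $s$ is finite and $$s\le \tfrac12(d+1).$$ -/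

import Mathlib

open Topology Filter

/-- Euclidean space `ℝⁿ`. -/
abbrev Euc (n : ℕ) : Type := EuclideanSpace ℝ (Fin n)

/-! ## Topological knots and knot types

The circle `S¹` and the sphere `Sⁿ` are taken as the one point compactifications
`ℝ ∪ {∞}` and `ℝⁿ ∪ {∞}`, as stereographic projection identifies them. -/

/-- A topological knot: a continuous embedding of `S¹ = ℝ ∪ {∞}` in `Sⁿ = ℝⁿ ∪ {∞}`.
(The circle is compact and the sphere is Hausdorff, so that an embedding is the same as an
injective continuous map.) -/
structure TopologicalKnot (n : ℕ) where
  toMap : C(OnePoint ℝ, OnePoint (Euc n))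
  injective : Function.Injective toMap

/-- A self-homeomorphism of a sphere `ℝⁿ ∪ {∞}` preserves the orientation iff it has degree `1`,
that is (Hopf), iff it is homotopic to the identity map. -/
def IsOrientationPreserving {X : Type*} [TopologicalSpace X] (f : X ≃ₜ X) : Prop :=
  ContinuousMap.Homotopic (f : C(X, X)) (ContinuousMap.id X)

/-- Topological equivalence of knots ("same knot type"): `α₀ = g ∘ α₁ ∘ f` for
orientation-preserving homeomorphisms `f` of `S¹` and `g` of `Sⁿ`. -/
def SameKnotType {n : ℕ} (α₀ α₁ : TopologicalKnot n) : Prop :=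
  ∃ (f : OnePoint ℝ ≃ₜ OnePoint ℝ) (g : OnePoint (Euc n) ≃ₜ OnePoint (Euc n)),
    IsOrientationPreserving f ∧ IsOrientationPreserving g ∧
      ∀ p, α₀.toMap p = g (α₁.toMap (f p))

/-- A knot lying in the affine part `ℝⁿ` of the sphere `ℝⁿ ∪ {∞}`. -/
structure EuclideanKnot (n : ℕ) where
  toMap : C(OnePoint ℝ, Euc n)
  injective : Function.Injective toMap

/-- A knot in `ℝⁿ`, regarded as a knot in the sphere `ℝⁿ ∪ {∞}`. -/
def EuclideanKnot.toTopologicalKnot {n : ℕ} (K : EuclideanKnot n) : TopologicalKnot n where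
  toMap := ⟨fun p => (K.toMap p : OnePoint (Euc n)),
    OnePoint.continuous_coe.comp K.toMap.continuous⟩
  injective := OnePoint.coe_injective.comp K.injective

/-! ## Local maxima and the superbridge number -/

/-- The local maxima of a real function `h`, a plateau counting as one local maximum: the
connected components of level sets of `h` all of whose points are local maximum points of `h`. -/
def localMaxima {X : Type*} [TopologicalSpace X] (h : X → ℝ) : Set (Set X) :=
  {C | ∃ x, C = connectedComponentIn {y | h y = h x} x ∧ ∀ y ∈ C, IsLocalMax h y}

/-- The number of local maxima (possibly infinite) of the knot `K` in the direction `v`. -/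
noncomputable def EuclideanKnot.numLocalMaxima {n : ℕ} (K : EuclideanKnot n) (v : Euc n) : ℕ∞ :=
  (localMaxima fun p => inner ℝ v (K.toMap p)).encard

/-- The superbridge number of a topological knot `K` in `S³`: the minimum, over all knots `K'` in
`ℝ³` of the same knot type as `K`, of the maximum, over all directions (unit vectors) `v`, of the
number of local maxima of `K'` in the direction `v`. -/
noncomputable def superbridgeNumber (K : TopologicalKnot 3) : ℕ∞ :=
  ⨅ (K' : EuclideanKnot 3) (_ : SameKnotType K'.toTopologicalKnot K),
    ⨆ v ∈ Metric.sphere (0 : Euc 3) 1, K'.numLocalMaxima v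

/-! ## Polynomial knots -/

/-- A polynomial knot: a smooth embedding `κ : ℝ → ℝⁿ` whose components are polynomials, i.e.
`κ(s) ≠ κ(t)` for `s ≠ t`, and `κ'(t) ≠ 0` for all `t`. (An injective polynomial map is
automatically proper, hence a closed topological embedding.) -/
structure PolynomialKnot (n : ℕ) where
  coord : Fin n → Polynomial ℝ
  injective : ∀ s t : ℝ, (∀ i, (coord i).eval s = (coord i).eval t) → s = t
  immersive : ∀ t : ℝ, ∃ i, (coord i).derivative.eval t ≠ 0

namespace PolynomialKnot

variable {n : ℕ}

/-- The map `ℝ → ℝⁿ` given by a polynomial knot. -/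
noncomputable def toFun (κ : PolynomialKnot n) (t : ℝ) : Euc n :=
  WithLp.toLp 2 fun i => (κ.coord i).eval t

/-- The degree of a polynomial knot: the maximum of the degrees of its components. -/
noncomputable def degree (κ : PolynomialKnot n) : ℕ :=
  Finset.univ.sup fun i => (κ.coord i).natDegree

theorem toFun_injective (κ : PolynomialKnot n) : Function.Injective κ.toFun := fun s t h =>
  κ.injective s t fun i => congrArg (fun x : Euc n => x i) h

theorem continuous_toFun (κ : PolynomialKnot n) : Continuous κ.toFun :=
  (PiLp.continuous_toLp 2 _).comp (continuous_pi fun i => (κ.coord i).continuous)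

theorem tendsto_toFun (κ : PolynomialKnot n) :
    Tendsto κ.toFun (coclosedCompact ℝ) (coclosedCompact (Euc n)) := by
  obtain ⟨i, hi⟩ := κ.immersive 0
  have hdeg : 0 < (κ.coord i).degree := by
    by_contra hle
    rw [Polynomial.eq_C_of_degree_le_zero (not_lt.mp hle)] at hi
    simp at hi
  rw [coclosedCompact_eq_cocompact, coclosedCompact_eq_cocompact,
    ← Metric.cobounded_eq_cocompact (α := Euc n), ← tendsto_norm_atTop_iff_cobounded]
  refine tendsto_atTop_mono (fun t => ?_)
    ((κ.coord i).tendsto_norm_atTop hdeg (tendsto_norm_cocompact_atTop (E := ℝ)))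
  exact PiLp.norm_apply_le (κ.toFun t) i

/-- The completion (one point compactification) `κ̄ : S¹ → Sⁿ` of a polynomial knot `κ`: the
extension of `κ` by `κ̄(∞) = ∞`. -/
noncomputable def completion (κ : PolynomialKnot n) : TopologicalKnot n where
  toMap := ⟨OnePoint.map κ.toFun, OnePoint.continuous_map κ.continuous_toFun κ.tendsto_toFun⟩
  injective := Option.map_injective κ.toFun_injective

end PolynomialKnot

/-!
In even degree `2m` some coordinate, up to sign, tends to `+∞` strictly monotonically on both tails.
Cut the curve just above a high plane, leaving an arc whose endpoints lie on that plane, and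
straighten the two tails to vertical rays. The parabolic inversion `(w, c) ↦ (w / N, c / N²)`,
`N = max ‖w‖² |c|`, exchanges `∞` with the origin, so that the two rays together with `∞` become an
arc through the origin; a vertical push off the rest of the knot flattens this arc, and inverting
back folds the two tails and `∞` onto the segment joining the endpoints of the arc. In every
direction the resulting closed knot is a polynomial of degree at most `2m` on the arc and affine on
the segment; its derivative has at most `2m - 1` zeros, and consecutive local maxima are separated
by critical points, which leaves at most `m` local maxima.

In odd degree `2m + 1` the degree is first raised to `2m + 2`. Let `z` be a coordinate of odd
degree. On the knot the time `t` is a Lipschitz function of the point, and on the tails it is a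
function of `z` alone. Hence `t * z(t)` extends to a continuous function on the space which is
Lipschitz along another coordinate axis, and for small `ε` the shear adding `ε t z(t)` to that
coordinate comes from an ambient isotopy.
-/

namespace IsOrientationPreserving

variable {X Y : Type*} [TopologicalSpace X] [TopologicalSpace Y]

theorem refl : IsOrientationPreserving (Homeomorph.refl X) :=
  ContinuousMap.Homotopic.refl _

theorem trans {f g : X ≃ₜ X} (hf : IsOrientationPreserving f) (hg : IsOrientationPreserving g) :
    IsOrientationPreserving (f.trans g) :=
  ContinuousMap.Homotopic.comp hg hf

theorem conj {f : X ≃ₜ X} (hf : IsOrientationPreserving f) (e : X ≃ₜ Y) :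
    IsOrientationPreserving ((e.symm.trans f).trans e) := by
  have hconj : ContinuousMap.Homotopic
      ((e : C(X, Y)).comp ((f : C(X, X)).comp (e.symm : C(Y, X))))
      ((e : C(X, Y)).comp ((ContinuousMap.id X).comp (e.symm : C(Y, X)))) :=
    (ContinuousMap.Homotopic.refl _).comp (hf.comp (ContinuousMap.Homotopic.refl _))
  have hid : (e : C(X, Y)).comp ((ContinuousMap.id X).comp (e.symm : C(Y, X))) =
      ContinuousMap.id Y := by
    ext y
    simp
  rwa [hid] at hconj

end IsOrientationPreserving

/-! ## Moving a knot by homeomorphisms of the sphere -/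

namespace TopologicalKnot

variable {n : ℕ}

/-- The image `g ∘ α` of a knot `α` under a homeomorphism `g` of the sphere. -/
def map (α : TopologicalKnot n) (g : OnePoint (Euc n) ≃ₜ OnePoint (Euc n)) :
    TopologicalKnot n where
  toMap := ⟨g ∘ α.toMap, g.continuous.comp α.toMap.continuous⟩
  injective := g.injective.comp α.injective

theorem exists_toTopologicalKnot_eq {α : TopologicalKnot n} (hα : ∀ p, α.toMap p ≠ OnePoint.infty) :
    ∃ K : EuclideanKnot n, K.toTopologicalKnot = α := by
  choose k hk using fun p => OnePoint.ne_infty_iff_exists.1 (hα p)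
  have hcont : Continuous k := by
    rw [OnePoint.isOpenEmbedding_coe.isInducing.continuous_iff]
    exact α.toMap.continuous.congr fun p => (hk p).symm
  have hinj : Function.Injective k := fun p q h => α.injective (by rw [← hk p, ← hk q, h])
  refine ⟨⟨⟨k, hcont⟩, hinj⟩, ?_⟩
  obtain ⟨⟨a, ha⟩, hinj⟩ := α
  simp only [EuclideanKnot.toTopologicalKnot, TopologicalKnot.mk.injEq]
  exact ContinuousMap.ext hk

end TopologicalKnot

theorem superbridgeNumber_le_map (α : TopologicalKnot 3)
    {g : OnePoint (Euc 3) ≃ₜ OnePoint (Euc 3)} (hg : IsOrientationPreserving g) :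
    superbridgeNumber α ≤ superbridgeNumber (α.map g) :=
  le_iInf₂ fun K ⟨f, k, hf, hk, hK⟩ => iInf₂_le K ⟨f, g.trans k, hf, hg.trans hk, hK⟩

theorem EuclideanKnot.superbridgeNumber_le (K : EuclideanKnot 3) :
    superbridgeNumber K.toTopologicalKnot ≤
      ⨆ v ∈ Metric.sphere (0 : Euc 3) 1, K.numLocalMaxima v :=
  iInf₂_le K ⟨Homeomorph.refl _, Homeomorph.refl _, .refl, .refl, fun _ => rfl⟩

/-! ## Ambient isotopies -/

theorem continuous_onePointMap_of_isProperMap {S X Y : Type*} [TopologicalSpace S]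
    [TopologicalSpace X] [R1Space X] [TopologicalSpace Y] {F : S × X → Y} (hF : IsProperMap F) :
    Continuous fun p : S × OnePoint X => OnePoint.map (fun x => F (p.1, x)) p.2 := by
  rw [continuous_iff_continuousAt]
  rintro ⟨s, x⟩
  induction x using OnePoint.rec with
  | infty =>
    refine (OnePoint.le_nhds_infty).2 fun K _ hK => mem_map.2 ?_
    have hcompact : IsCompact (closure (Prod.snd '' (F ⁻¹' K))) :=
      ((hF.isCompact_preimage hK).image continuous_snd).closure
    have hnhds := (OnePoint.isOpen_compl_image_coe.2 ⟨isClosed_closure, hcompact⟩).mem_nhds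
      (OnePoint.infty_notMem_image_coe)
    refine mem_of_superset (prod_mem_nhds univ_mem hnhds) ?_
    rintro ⟨s, y⟩ ⟨-, hy⟩
    induction y using OnePoint.rec with
    | infty => exact Or.inr rfl
    | coe y =>
      have hFy : F (s, y) ∉ K := fun hyK => hy ⟨y, subset_closure ⟨(s, y), hyK, rfl⟩, rfl⟩
      exact Or.inl ⟨F (s, y), hFy, rfl⟩
  | coe x =>
    refine ((IsOpenEmbedding.id.prodMap OnePoint.isOpenEmbedding_coe).continuousAt_iff
      (x := (s, x))).1 ?_
    exact (OnePoint.continuous_coe.comp hF.continuous).continuousAt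

theorem exists_isOrientationPreserving_of_isProperMap {X : Type*} [TopologicalSpace X] [T2Space X]
    [WeaklyLocallyCompactSpace X] {F : unitInterval × X → X} (hF : IsProperMap F)
    (hF₀ : ∀ x, F (0, x) = x) (hF₁ : Function.Bijective fun x => F (1, x)) :
    ∃ g : OnePoint X ≃ₜ OnePoint X, IsOrientationPreserving g ∧ g OnePoint.infty = OnePoint.infty ∧
      ∀ x : X, g x = (F (1, x) : X) := by
  have hcont := continuous_onePointMap_of_isProperMap hF
  have hbij : Function.Bijective (OnePoint.map fun x => F (1, x)) :=
    ((Equiv.ofBijective _ hF₁).optionCongr).bijective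
  have hcont₁ : Continuous (Equiv.ofBijective _ hbij) := hcont.comp (Continuous.prodMk_right 1)
  refine ⟨hcont₁.homeoOfEquivCompactToT2, .symm ⟨⟨⟨_, hcont⟩, fun x => ?_, fun _ => rfl⟩⟩, rfl,
    fun _ => rfl⟩
  induction x using OnePoint.rec with
  | infty => rfl
  | coe x => exact congrArg _ (hF₀ x)

theorem isProperMap_of_norm_le {S E F : Type*} [TopologicalSpace S] [CompactSpace S]
    [NormedAddCommGroup E] [ProperSpace E] [NormedAddCommGroup F] [ProperSpace F] {f : S × E → F}
    (hf : Continuous f) (h : ∀ R : ℝ, ∃ R' : ℝ, ∀ s x, ‖f (s, x)‖ ≤ R → ‖x‖ ≤ R') :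
    IsProperMap f := by
  refine isProperMap_iff_isCompact_preimage.2 ⟨hf, fun K hK => ?_⟩
  obtain ⟨R, hR⟩ := hK.isBounded.exists_norm_le
  obtain ⟨R', hR'⟩ := h R
  refine (isCompact_univ.prod (isCompact_closedBall (0 : E) R')).of_isClosed_subset
    (hK.isClosed.preimage hf) fun p hp => ⟨Set.mem_univ _, ?_⟩
  exact mem_closedBall_zero_iff.2 (hR' p.1 p.2 (hR _ hp))

theorem bijective_add_smul_of_contractingWith {E : Type*} [AddCommGroup E] [Module ℝ E]
    {e : E} {φ : E → ℝ} (hφ : ∀ x, ∃ K, ContractingWith K fun r : ℝ => φ (x + r • e)) :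
    Function.Bijective fun x => x + φ x • e := by
  refine (Function.bijective_iff_existsUnique _).2 fun y => ?_
  obtain ⟨K, hK⟩ := hφ y
  -- The solutions of `x + φ x • e = y` are the points `y + r • e` with `r = -φ (y + r • e)`.
  have hneg : ContractingWith K fun r : ℝ => -φ (y + r • e) := ⟨hK.1, hK.2.neg⟩
  have hfix : -φ (y + hneg.fixedPoint • e) = hneg.fixedPoint := hneg.fixedPoint_isFixedPt
  refine ⟨y + hneg.fixedPoint • e, ?_, fun x hx => ?_⟩
  · change y + _ + φ (y + _) • e = y
    rw [← neg_neg (φ _), hfix, neg_smul, add_neg_cancel_right]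
  · have hx' : y + (-φ x) • e = x := by rw [← hx, neg_smul, add_neg_cancel_right]
    have hfix' : Function.IsFixedPt (fun r : ℝ => -φ (y + r • e)) (-φ x) := by
      simp only [Function.IsFixedPt, hx']
    rw [← hneg.fixedPoint_unique hfix', hx']

theorem exists_isOrientationPreserving_add_smul {E : Type*} [NormedAddCommGroup E]
    [NormedSpace ℝ E] [ProperSpace E] {e : E} {φ : E → ℝ} (hφ : Continuous φ)
    (hcontr : ∀ x, ∃ K, ContractingWith K fun r : ℝ => φ (x + r • e))
    (hproper : ∀ R, ∃ R', ∀ (s : unitInterval) x, ‖x + (s * φ x) • e‖ ≤ R → ‖x‖ ≤ R') :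
    ∃ g : OnePoint E ≃ₜ OnePoint E, IsOrientationPreserving g ∧ g OnePoint.infty = OnePoint.infty ∧
      ∀ x : E, g x = (x + φ x • e : E) := by
  have hF : IsProperMap fun p : unitInterval × E => p.2 + (p.1 * φ p.2) • e :=
    isProperMap_of_norm_le (by fun_prop) hproper
  obtain ⟨g, hg, hginf, hgx⟩ := exists_isOrientationPreserving_of_isProperMap hF
    (fun x => by simp) (by simpa using bijective_add_smul_of_contractingWith hcontr)
  exact ⟨g, hg, hginf, fun x => by simpa using hgx x⟩

theorem exists_isOrientationPreserving_add_smul_of_bounded {E : Type*} [NormedAddCommGroup E]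
    [NormedSpace ℝ E] [ProperSpace E] {e : E} {φ : E → ℝ} (hφ : Continuous φ)
    (hcontr : ∀ x, ∃ K, ContractingWith K fun r : ℝ => φ (x + r • e)) {C : ℝ}
    (hC : ∀ x, |φ x| ≤ C) :
    ∃ g : OnePoint E ≃ₜ OnePoint E, IsOrientationPreserving g ∧ g OnePoint.infty = OnePoint.infty ∧
      ∀ x : E, g x = (x + φ x • e : E) := by
  refine exists_isOrientationPreserving_add_smul hφ hcontr fun R =>
    ⟨R + C * ‖e‖, fun s x hx => ?_⟩
  have hmove : ‖(s * φ x) • e‖ ≤ C * ‖e‖ := by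
    rw [norm_smul, Real.norm_eq_abs, abs_mul, abs_of_nonneg s.2.1]
    exact mul_le_mul_of_nonneg_right
      ((mul_le_of_le_one_left (abs_nonneg _) s.2.2).trans (hC x)) (norm_nonneg e)
  calc ‖x‖ = ‖x + (s * φ x) • e - (s * φ x) • e‖ := by rw [add_sub_cancel_right]
    _ ≤ R + C * ‖e‖ := (norm_sub_le _ _).trans (add_le_add hx hmove)

theorem exists_isOrientationPreserving_mul_add {A B : ℝ → ℂ} (hA : Continuous A)
    (hB : Continuous B) (hA_ne : ∀ c, A c ≠ 0) (hA₀ : A 0 = 1) (hB₀ : B 0 = 0) :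
    ∃ g : OnePoint (ℂ × ℝ) ≃ₜ OnePoint (ℂ × ℝ), IsOrientationPreserving g ∧
      g OnePoint.infty = OnePoint.infty ∧
      ∀ (w : ℂ) (c : ℝ), g ((w, c) : ℂ × ℝ) = ((A c * w + B c, c) : ℂ × ℝ) := by
  let Φ : unitInterval × (ℂ × ℝ) ≃ₜ unitInterval × (ℂ × ℝ) :=
    { toFun p := (p.1, A (p.1 * p.2.2) * p.2.1 + B (p.1 * p.2.2), p.2.2)
      invFun p := (p.1, (p.2.1 - B (p.1 * p.2.2)) / A (p.1 * p.2.2), p.2.2)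
      left_inv p := by ext <;> simp [hA_ne]
      right_inv p := by ext <;> simp [hA_ne, mul_div_cancel₀]
      continuous_toFun := by fun_prop
      continuous_invFun := by fun_prop (disch := exact fun _ => hA_ne _) }
  have hF : IsProperMap fun p => (Φ p).2 := isProperMap_snd_of_compactSpace.comp Φ.isProperMap
  have hbij : Function.Bijective fun x => (Φ (1, x)).2 :=
    Function.bijective_iff_has_inverse.2 ⟨fun x => (Φ.symm (1, x)).2,
      fun x => congrArg Prod.snd (Φ.symm_apply_apply (1, x)),
      fun x => congrArg Prod.snd (Φ.apply_symm_apply (1, x))⟩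
  obtain ⟨g, hg, hginf, hgx⟩ :=
    exists_isOrientationPreserving_of_isProperMap hF (fun x => by simp [Φ, hA₀, hB₀]) hbij
  exact ⟨g, hg, hginf, fun w c => by simpa [Φ] using hgx (w, c)⟩

/-! ## Parabolic inversion -/

section ParabolicInversion

variable {E : Type*} [NormedAddCommGroup E]

/-- The gauge `max (‖w‖²) |c|` of a point `(w, c)` of `E × ℝ`, homogeneous of degree `2` for the
parabolic dilations `(w, c) ↦ (r • w, r² c)`. -/
def parabolicGauge (p : E × ℝ) : ℝ := max (‖p.1‖ ^ 2) |p.2|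

theorem continuous_parabolicGauge : Continuous (parabolicGauge : E × ℝ → ℝ) := by
  unfold parabolicGauge
  fun_prop

@[simp]
theorem parabolicGauge_zero : parabolicGauge (0 : E × ℝ) = 0 := by simp [parabolicGauge]

theorem parabolicGauge_pos {p : E × ℝ} (hp : p ≠ 0) : 0 < parabolicGauge p := by
  contrapose! hp
  have hnorm : ‖p.1‖ ^ 2 ≤ 0 := (le_max_left _ _).trans hp
  have habs : |p.2| ≤ 0 := (le_max_right _ _).trans hp
  exact Prod.ext (by simpa using hnorm) (by simpa using habs)

theorem norm_le_parabolicGauge_add_one (p : E × ℝ) : ‖p‖ ≤ parabolicGauge p + 1 := by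
  have hnorm : ‖p.1‖ ^ 2 ≤ parabolicGauge p := le_max_left _ _
  have habs : |p.2| ≤ parabolicGauge p := le_max_right _ _
  exact max_le (by nlinarith [sq_nonneg (‖p.1‖ - 1)]) (habs.trans (by linarith))

theorem norm_le_sqrt_parabolicGauge_add (p : E × ℝ) :
    ‖p‖ ≤ √(parabolicGauge p) + parabolicGauge p := by
  have hnorm : ‖p.1‖ ≤ √(parabolicGauge p) := Real.le_sqrt_of_sq_le (le_max_left _ _)
  have habs : |p.2| ≤ parabolicGauge p := le_max_right _ _
  exact max_le (by linarith [abs_nonneg p.2]) (habs.trans (by linarith [norm_nonneg p.1]))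

theorem tendsto_parabolicGauge_cocompact [ProperSpace E] :
    Tendsto parabolicGauge (cocompact (E × ℝ)) atTop :=
  tendsto_atTop_mono (fun p => sub_le_iff_le_add.2 (norm_le_parabolicGauge_add_one p))
    (tendsto_atTop_add_const_right _ (-1) (tendsto_norm_cocompact_atTop (E := E × ℝ)))

theorem tendsto_zero_of_parabolicGauge {α : Type*} {l : Filter α} {f : α → E × ℝ}
    (hf : Tendsto (fun a => parabolicGauge (f a)) l (𝓝 0)) : Tendsto f l (𝓝 0) :=
  squeeze_zero_norm (fun a => norm_le_sqrt_parabolicGauge_add (f a))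
    (by simpa using hf.sqrt.add hf)

variable [NormedSpace ℝ E]

theorem parabolicGauge_smul_sq_mul (r : ℝ) (p : E × ℝ) :
    parabolicGauge (r • p.1, r ^ 2 * p.2) = r ^ 2 * parabolicGauge p := by
  simp [parabolicGauge, mul_max_of_nonneg, sq_nonneg, norm_smul, mul_pow, abs_mul]

/-- The inversion `(w, c) ↦ (w / N, c / N²)`, where `N = max (‖w‖²) |c|`. -/
noncomputable def parabolicInversion (p : E × ℝ) : E × ℝ :=
  ((parabolicGauge p)⁻¹ • p.1, (parabolicGauge p ^ 2)⁻¹ * p.2)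

theorem parabolicGauge_parabolicInversion (p : E × ℝ) :
    parabolicGauge (parabolicInversion p) = (parabolicGauge p)⁻¹ := by
  rcases eq_or_ne p 0 with rfl | hp
  · simp [parabolicInversion, parabolicGauge]
  have hpos := parabolicGauge_pos hp
  rw [parabolicInversion, ← inv_pow, parabolicGauge_smul_sq_mul]
  field_simp

theorem parabolicInversion_ne_zero {p : E × ℝ} (hp : p ≠ 0) : parabolicInversion p ≠ 0 := fun h =>
  (inv_pos.2 (parabolicGauge_pos hp)).ne
    (by rw [← parabolicGauge_parabolicInversion, h, parabolicGauge_zero])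

theorem parabolicInversion_involutive :
    Function.Involutive (parabolicInversion : E × ℝ → E × ℝ) := by
  intro p
  rcases eq_or_ne p 0 with rfl | hp
  · simp [parabolicInversion]
  have hne := (parabolicGauge_pos hp).ne'
  rw [parabolicInversion, parabolicGauge_parabolicInversion]
  ext
  · simp [parabolicInversion, smul_smul, hne]
  · simp [parabolicInversion, hne]

theorem parabolicInversion_of_sq_norm_le {w : E} {c : ℝ} (h : ‖w‖ ^ 2 ≤ c) :
    parabolicInversion (w, c) = (c⁻¹ • w, c⁻¹) := by
  have hc : 0 ≤ c := (sq_nonneg _).trans h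
  have hgauge : parabolicGauge (w, c) = c := by simp [parabolicGauge, abs_of_nonneg hc, h]
  rcases hc.eq_or_lt with rfl | hc
  · simp [parabolicInversion, hgauge]
  · rw [parabolicInversion, hgauge]
    ext
    · rfl
    · simp; field_simp

theorem continuousAt_parabolicInversion {p : E × ℝ} (hp : p ≠ 0) :
    ContinuousAt parabolicInversion p := by
  have hne := (parabolicGauge_pos hp).ne'
  have hcont := (continuous_parabolicGauge (E := E)).continuousAt (x := p)
  exact ((hcont.inv₀ hne).smul continuousAt_fst).prodMk
    (((hcont.pow 2).inv₀ (pow_ne_zero 2 hne)).mul continuousAt_snd)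

theorem tendsto_parabolicInversion_cocompact [ProperSpace E] :
    Tendsto parabolicInversion (cocompact (E × ℝ)) (𝓝 0) := by
  refine tendsto_zero_of_parabolicGauge ?_
  simp only [parabolicGauge_parabolicInversion]
  exact tendsto_inv_atTop_zero.comp tendsto_parabolicGauge_cocompact

theorem tendsto_parabolicInversion_zero :
    Tendsto (parabolicInversion : E × ℝ → E × ℝ) (𝓝[≠] 0) (cocompact (E × ℝ)) := by
  have hgauge : Tendsto (parabolicGauge : E × ℝ → ℝ) (𝓝[≠] 0) (𝓝[>] 0) := by
    refine tendsto_nhdsWithin_of_tendsto_nhds_of_eventually_within _ ?_ ?_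
    · simpa using ((continuous_parabolicGauge (E := E)).tendsto 0).mono_left nhdsWithin_le_nhds
    · filter_upwards [self_mem_nhdsWithin] with p hp using parabolicGauge_pos hp
  have htop : Tendsto (fun p : E × ℝ => parabolicGauge (parabolicInversion p)) (𝓝[≠] 0) atTop := by
    simpa only [parabolicGauge_parabolicInversion] using! tendsto_inv_nhdsGT_zero.comp hgauge
  exact (tendsto_comap_iff.2 (htop.mono_right atTop_le_cocompact)).mono_right
    (comap_cocompact_le continuous_parabolicGauge)

open Classical in
/-- The extension of the parabolic inversion to `E × ℝ ∪ {∞}`, exchanging `0` and `∞`. -/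
noncomputable def onePointParabolicInversion : OnePoint (E × ℝ) → OnePoint (E × ℝ) :=
  fun x => x.elim ((0 : E × ℝ) : OnePoint (E × ℝ))
    fun p => if p = 0 then OnePoint.infty else (parabolicInversion p : E × ℝ)

theorem onePointParabolicInversion_infty :
    onePointParabolicInversion OnePoint.infty = ((0 : E × ℝ) : OnePoint (E × ℝ)) := rfl

theorem onePointParabolicInversion_zero :
    onePointParabolicInversion ((0 : E × ℝ) : OnePoint (E × ℝ)) = OnePoint.infty := by
  simp [onePointParabolicInversion]

theorem onePointParabolicInversion_coe {p : E × ℝ} (hp : p ≠ 0) :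
    onePointParabolicInversion (p : OnePoint (E × ℝ)) = (parabolicInversion p : E × ℝ) := by
  simp [onePointParabolicInversion, hp]

theorem onePointParabolicInversion_involutive :
    Function.Involutive (onePointParabolicInversion : OnePoint (E × ℝ) → OnePoint (E × ℝ)) := by
  intro x
  induction x using OnePoint.rec with
  | infty => rw [onePointParabolicInversion_infty, onePointParabolicInversion_zero]
  | coe p =>
    rcases eq_or_ne p 0 with rfl | hp
    · rw [onePointParabolicInversion_zero, onePointParabolicInversion_infty]
    · rw [onePointParabolicInversion_coe hp,
        onePointParabolicInversion_coe (parabolicInversion_ne_zero hp),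
        parabolicInversion_involutive]

theorem continuous_onePointParabolicInversion [ProperSpace E] :
    Continuous (onePointParabolicInversion : OnePoint (E × ℝ) → OnePoint (E × ℝ)) := by
  have heq : ∀ {l : Filter (E × ℝ)}, (∀ᶠ p in l, p ≠ 0) →
      (fun p => ((parabolicInversion p : E × ℝ) : OnePoint (E × ℝ))) =ᶠ[l]
        onePointParabolicInversion ∘ (↑) := fun hl => by
    filter_upwards [hl] with p hp using (onePointParabolicInversion_coe hp).symm
  rw [continuous_iff_continuousAt]
  intro x
  induction x using OnePoint.rec with
  | infty =>
    rw [OnePoint.continuousAt_infty', coclosedCompact_eq_cocompact]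
    refine Tendsto.congr' (heq (isCompact_singleton.compl_mem_cocompact)) ?_
    exact (OnePoint.continuous_coe.tendsto 0).comp tendsto_parabolicInversion_cocompact
  | coe p =>
    rw [OnePoint.continuousAt_coe]
    rcases eq_or_ne p 0 with rfl | hp
    · rw [continuousAt_iff_punctured_nhds, Function.comp_apply, onePointParabolicInversion_zero]
      refine Tendsto.congr' (heq self_mem_nhdsWithin) (OnePoint.tendsto_coe_infty.comp ?_)
      rw [coclosedCompact_eq_cocompact]
      exact tendsto_parabolicInversion_zero
    · refine ContinuousAt.congr ?_ (heq (isOpen_ne.mem_nhds hp))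
      exact OnePoint.continuous_coe.continuousAt.comp (continuousAt_parabolicInversion hp)

/-- The parabolic inversion as a homeomorphism of `E × ℝ ∪ {∞}`. -/
noncomputable def parabolicInversionHomeomorph [ProperSpace E] :
    OnePoint (E × ℝ) ≃ₜ OnePoint (E × ℝ) where
  toEquiv := onePointParabolicInversion_involutive.toPerm
  continuous_toFun := continuous_onePointParabolicInversion
  continuous_invFun := continuous_onePointParabolicInversion

end ParabolicInversion

/-! ## Pushing rays off a closed set -/

/-- The height by which a point at height `u` is lifted: a nonincreasing piecewise affine function
of `u`, equal to `τ` for `u ≤ ρ - τ` and, if `τ ≤ ρ`, to `0` for `ρ + δ ≤ u`. -/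
noncomputable def pushHeight (ρ τ δ u : ℝ) : ℝ :=
  max 0 (min τ ((τ * δ - ρ * (u - ρ)) / (ρ + δ)))

section PushHeight

variable {ρ τ δ u : ℝ}

theorem pushHeight_mem_Icc (hτ : 0 ≤ τ) : pushHeight ρ τ δ u ∈ Set.Icc 0 τ :=
  ⟨le_max_left _ _, max_le hτ (min_le_left _ _)⟩

theorem pushHeight_sub_self (hρ : 0 < ρ) (hτ : 0 ≤ τ) (hδ : 0 ≤ δ) :
    pushHeight ρ τ δ (ρ - τ) = τ := by
  have hne : ρ + δ ≠ 0 := by positivity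
  have hratio : (τ * δ - ρ * (ρ - τ - ρ)) / (ρ + δ) = τ := by
    field_simp
    ring
  rw [pushHeight, hratio, min_self, max_eq_right hτ]

theorem pushHeight_eq_zero (hρ : 0 < ρ) (hτρ : τ ≤ ρ) (hδ : 0 ≤ δ) (hu : ρ + δ ≤ u) :
    pushHeight ρ τ δ u = 0 := by
  refine max_eq_left ((min_le_right _ _).trans (div_nonpos_of_nonpos_of_nonneg ?_ ?_))
  · nlinarith
  · positivity

theorem exists_contractingWith_pushHeight (hρ : 0 < ρ) (hδ : 0 ≤ δ) (h : δ = 0 → τ = 0) :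
    ∃ K, ContractingWith K (pushHeight ρ τ δ) := by
  rcases hδ.eq_or_lt with rfl | hδ
  · have hconst : pushHeight ρ τ 0 = fun _ => 0 := by
      funext u
      simp [pushHeight, h rfl]
    exact ⟨0, zero_lt_one, hconst ▸ LipschitzWith.const 0⟩
  refine ⟨(ρ / (ρ + δ)).toNNReal, ?_, ?_⟩
  · rw [Real.toNNReal_lt_one, div_lt_one (by positivity)]
    linarith
  · refine (LipschitzWith.const_min ?_ _).const_max _
    refine LipschitzWith.of_dist_le_mul fun u v => ?_
    rw [Real.coe_toNNReal _ (by positivity), Real.dist_eq, Real.dist_eq, ← sub_div, abs_div,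
      abs_of_pos (by positivity : 0 < ρ + δ), show τ * δ - ρ * (u - ρ) - (τ * δ - ρ * (v - ρ)) =
        -(ρ * (u - v)) by ring, abs_neg, abs_mul, abs_of_pos hρ, mul_div_right_comm]

end PushHeight

theorem exists_isOrientationPreserving_push {E : Type*} [NormedAddCommGroup E] [NormedSpace ℝ E]
    [ProperSpace E] {A : Set (E × ℝ)} (hA : IsClosed A) (hA_ne : A.Nonempty) {ρ : ℝ} (hρ : 0 < ρ)
    (hA_le : ∀ p ∈ A, ρ ≤ p.2) (hA_norm : ∀ p ∈ A, p.2 = ρ → ‖p.1‖ = ρ) :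
    ∃ g : OnePoint (E × ℝ) ≃ₜ OnePoint (E × ℝ), IsOrientationPreserving g ∧
      (∀ p ∈ A, g p = (p : OnePoint (E × ℝ))) ∧
      ∀ w : E, ‖w‖ ≤ ρ → g ((w, ‖w‖) : E × ℝ) = ((w, ρ) : E × ℝ) := by
  let τ : E → ℝ := fun w => max 0 (ρ - ‖w‖)
  let δ : E → ℝ := fun w => Metric.infDist (w, ρ) A
  let φ : E × ℝ → ℝ := fun p => pushHeight ρ (τ p.1) (δ p.1) p.2
  have hτ_nonneg : ∀ w, 0 ≤ τ w := fun w => le_max_left _ _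
  have hτ_le : ∀ w, τ w ≤ ρ := fun w => max_le hρ.le (sub_le_self _ (norm_nonneg w))
  have hδ_nonneg : ∀ w, 0 ≤ δ w := fun w => Metric.infDist_nonneg
  have hτ_zero : ∀ w, δ w = 0 → τ w = 0 := fun w hw => by
    have hmem : (w, ρ) ∈ A := (hA.mem_iff_infDist_zero hA_ne).2 hw
    simp [τ, hA_norm _ hmem rfl]
  have hδ_le : ∀ p ∈ A, ρ + δ p.1 ≤ p.2 := fun p hp => by
    have hdist : δ p.1 ≤ dist (p.1, ρ) p := Metric.infDist_le_dist_of_mem hp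
    rw [Prod.dist_eq, dist_self, dist_comm, Real.dist_eq, max_eq_right (abs_nonneg _),
      abs_of_nonneg (sub_nonneg.2 (hA_le p hp))] at hdist
    linarith
  have hδ_cont : Continuous δ := (Metric.continuous_infDist_pt A).comp (by fun_prop)
  have hφ : Continuous φ := by
    have hne : ∀ p : E × ℝ, ρ + δ p.1 ≠ 0 := fun p =>
      (add_pos_of_pos_of_nonneg hρ (hδ_nonneg _)).ne'
    unfold φ pushHeight
    fun_prop (disch := assumption)
  have hcontr : ∀ p : E × ℝ, ∃ K,
      ContractingWith K fun r : ℝ => φ (p + r • ((0, 1) : E × ℝ)) := fun p => by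
    obtain ⟨K, hK₁, hK⟩ := exists_contractingWith_pushHeight hρ (hδ_nonneg p.1) (hτ_zero p.1)
    refine ⟨K, hK₁, ?_⟩
    simpa [φ, Function.comp_def] using hK.comp (isometry_add_left p.2).lipschitz
  have hbound : ∀ p, |φ p| ≤ ρ := fun p => by
    obtain ⟨hφ₀, hφ₁⟩ := pushHeight_mem_Icc (ρ := ρ) (δ := δ p.1) (u := p.2) (hτ_nonneg p.1)
    exact (abs_of_nonneg hφ₀).trans_le (hφ₁.trans (hτ_le _))
  obtain ⟨g, hg, -, hgφ⟩ := exists_isOrientationPreserving_add_smul_of_bounded hφ hcontr hbound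
  refine ⟨g, hg, fun p hp => ?_, fun w hw => ?_⟩
  · rw [hgφ, show φ p = 0 from
      pushHeight_eq_zero hρ (hτ_le _) (hδ_nonneg _) (hδ_le p hp), zero_smul, add_zero]
  · have hτ_eq : ρ - τ w = ‖w‖ := by simp [τ, hw]
    have hφw : φ (w, ‖w‖) = τ w := by
      simpa only [hτ_eq] using pushHeight_sub_self hρ (hτ_nonneg w) (hδ_nonneg w)
    rw [hgφ, hφw]
    simp [← hτ_eq]

theorem parabolicInversionHomeomorph_coe {E : Type*} [NormedAddCommGroup E] [NormedSpace ℝ E]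
    [ProperSpace E] {w : E} {c : ℝ} (hc : 0 < c) (h : ‖w‖ ^ 2 ≤ c) :
    parabolicInversionHomeomorph (E := E) ((w, c) : E × ℝ) = ((c⁻¹ • w, c⁻¹) : E × ℝ) := by
  rw [← parabolicInversion_of_sq_norm_le h]
  exact onePointParabolicInversion_coe fun h0 => hc.ne' (congrArg Prod.snd h0)

theorem exists_isOrientationPreserving_foldRays {E : Type*} [NormedAddCommGroup E]
    [NormedSpace ℝ E] [ProperSpace E] {A : Set (E × ℝ)} (hA : IsCompact A) (hA_ne : A.Nonempty)
    {M : ℝ} (hM : 1 ≤ M) (hA_pos : ∀ p ∈ A, 0 < p.2) (hA_sq : ∀ p ∈ A, ‖p.1‖ ^ 2 ≤ p.2)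
    (hA_le : ∀ p ∈ A, p.2 ≤ M) (hA_norm : ∀ p ∈ A, p.2 = M → ‖p.1‖ = 1) :
    ∃ g : OnePoint (E × ℝ) ≃ₜ OnePoint (E × ℝ), IsOrientationPreserving g ∧
      (∀ p ∈ A, g p = (p : OnePoint (E × ℝ))) ∧
      (∀ (w : E) (c : ℝ), ‖w‖ = 1 → M ≤ c →
        g ((w, c) : E × ℝ) = (((M / c) • w, M) : E × ℝ)) ∧
      g OnePoint.infty = ((0, M) : E × ℝ) := by
  have hM₀ : 0 < M := one_pos.trans_le hM
  let ι : OnePoint (E × ℝ) ≃ₜ OnePoint (E × ℝ) := parabolicInversionHomeomorph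
  have hιι : ∀ x, ι (ι x) = x := onePointParabolicInversion_involutive
  have hcompact : IsCompact ((fun p : E × ℝ => (p.2⁻¹ • p.1, p.2⁻¹)) '' A) := by
    have hinv : ContinuousOn (fun p : E × ℝ => p.2⁻¹) A :=
      continuousOn_snd.inv₀ fun p hp => (hA_pos p hp).ne'
    exact hA.image_of_continuousOn ((hinv.smul continuousOn_fst).prodMk hinv)
  obtain ⟨V, hV, hVA, hVw⟩ := exists_isOrientationPreserving_push hcompact.isClosed
    (hA_ne.image _) (inv_pos.2 hM₀)
    (Set.forall_mem_image.2 fun p hp => inv_anti₀ (hA_pos p hp) (hA_le p hp))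
    (Set.forall_mem_image.2 fun p hp hpM => by
      have hpM' : p.2 = M := inv_injective hpM
      simp only [norm_smul, hA_norm p hp hpM', hpM', mul_one, norm_inv, Real.norm_eq_abs,
        abs_of_pos hM₀])
  have hfold : ∀ w : E, ‖w‖ ≤ M⁻¹ → ι (V ((w, ‖w‖) : E × ℝ)) = ((M • w, M) : E × ℝ) := by
    intro w hw
    have hMw : ‖M • w‖ ≤ 1 := by
      rwa [norm_smul, Real.norm_eq_abs, abs_of_pos hM₀, ← le_div_iff₀' hM₀, one_div]
    have hι : ι ((M • w, M) : E × ℝ) = ((w, M⁻¹) : E × ℝ) := by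
      rw [parabolicInversionHomeomorph_coe hM₀ ((pow_le_one₀ (norm_nonneg _) hMw).trans hM),
        inv_smul_smul₀ hM₀.ne']
    rw [hVw w hw, ← hι, hιι]
  refine ⟨(ι.symm.trans V).trans ι, hV.conj ι, fun p hp => ?_, fun w c hw hc => ?_, ?_⟩
  · have hιp : ι p = ((p.2⁻¹ • p.1, p.2⁻¹) : E × ℝ) :=
      parabolicInversionHomeomorph_coe (hA_pos p hp) (hA_sq p hp)
    change ι (V (ι p)) = p
    rw [hιp, hVA _ ⟨p, hp, rfl⟩, ← hιp, hιι]
  · have hc₀ : 0 < c := hM₀.trans_le hc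
    have hnorm : ‖c⁻¹ • w‖ = c⁻¹ := by
      rw [norm_smul, hw, mul_one, norm_inv, Real.norm_eq_abs, abs_of_pos hc₀]
    have hιw : ι ((w, c) : E × ℝ) = ((c⁻¹ • w, ‖c⁻¹ • w‖) : E × ℝ) := by
      rw [hnorm]
      exact parabolicInversionHomeomorph_coe hc₀ (by rw [hw, one_pow]; exact hM.trans hc)
    change ι (V (ι _)) = _
    rw [hιw, hfold _ (hnorm.trans_le (inv_anti₀ hM₀ hc)), smul_smul, div_eq_mul_inv]
  · simpa using! hfold 0 (by simpa using hM₀.le)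

/-! ## Closing a long knot by a segment -/

theorem exists_continuous_inverse_of_strictMonoOn_Ici {z : ℝ → ℝ} {b : ℝ}
    (hz : ContinuousOn z (Set.Ici b)) (hmono : StrictMonoOn z (Set.Ici b))
    (htop : Tendsto z atTop atTop) :
    ∃ θ : ℝ → ℝ, Continuous θ ∧ (∀ c, b ≤ θ c) ∧ (∀ t, b ≤ t → θ (z t) = t) ∧
      ∀ c, z (θ c) = max (z b) c := by
  have himage : z '' Set.Ici b = Set.Ici (z b) := by
    refine (Set.image_subset_iff.2 fun t ht => ?_).antisymm
      (isPreconnected_Ici.intermediate_value_Ici Set.self_mem_Ici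
        (le_principal_iff.2 (Ici_mem_atTop b)) hz htop)
    exact hmono.monotoneOn Set.self_mem_Ici ht ht
  let e : Set.Ici b ≃o Set.Ici (z b) :=
    (hmono.orderIso z (Set.Ici b)).trans (OrderIso.setCongr _ _ himage)
  have he : ∀ t, (e t : ℝ) = z t := fun t => rfl
  refine ⟨fun c => e.symm (Set.projIci (z b) c), ?_, fun c => (e.symm _).2, fun t ht => ?_,
    fun c => ?_⟩
  · exact continuous_subtype_val.comp (e.symm.continuous.comp
      ((continuous_const.max continuous_id).subtype_mk _))
  · have hproj : Set.projIci (z b) (z t) = e ⟨t, ht⟩ :=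
      Subtype.ext (max_eq_right (hmono.monotoneOn Set.self_mem_Ici ht ht))
    simp only [hproj, OrderIso.symm_apply_apply]
  · rw [← he, e.apply_symm_apply, Set.coe_projIci]

theorem exists_isOrientationPreserving_straighten {P Q : ℝ → ℂ} (hP : Continuous P)
    (hQ : Continuous Q) (hPQ : ∀ c, P c ≠ Q c) (hP₀ : P 0 = 1) (hQ₀ : Q 0 = -1) :
    ∃ g : OnePoint (ℂ × ℝ) ≃ₜ OnePoint (ℂ × ℝ), IsOrientationPreserving g ∧
      g OnePoint.infty = OnePoint.infty ∧
      (∀ c, g ((P c, c) : ℂ × ℝ) = ((1, c) : ℂ × ℝ)) ∧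
      (∀ c, g ((Q c, c) : ℂ × ℝ) = ((-1, c) : ℂ × ℝ)) ∧
      ∀ w c, P c = 1 → Q c = -1 → g ((w, c) : ℂ × ℝ) = ((w, c) : ℂ × ℝ) := by
  have hne : ∀ c, P c - Q c ≠ 0 := fun c => sub_ne_zero.2 (hPQ c)
  obtain ⟨g, hg, hginf, hgw⟩ := exists_isOrientationPreserving_mul_add
    (A := fun c => 2 / (P c - Q c)) (B := fun c => -(P c + Q c) / (P c - Q c))
    (by fun_prop (disch := exact hne)) (by fun_prop (disch := exact hne))
    (fun c => div_ne_zero two_ne_zero (hne c)) (by norm_num [hP₀, hQ₀]) (by norm_num [hP₀, hQ₀])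
  refine ⟨g, hg, hginf, fun c => ?_, fun c => ?_, fun w c hPc hQc => ?_⟩ <;> rw [hgw]
  · congr 2
    field [hne c]
  · congr 2
    field [hne c]
  · rw [hPc, hQc]
    norm_num

theorem exists_isOrientationPreserving_straighten_tails {γ : ℝ → ℂ × ℝ} (hγ : Continuous γ)
    (hinj : Function.Injective γ) {a b M : ℝ} (hab : a < b) (hM : 0 ≤ M) (ha : γ a = (-1, M))
    (hb : γ b = (1, M)) (hanti : StrictAntiOn (fun t => (γ t).2) (Set.Iic a))
    (hmono : StrictMonoOn (fun t => (γ t).2) (Set.Ici b))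
    (hbot : Tendsto (fun t => (γ t).2) atBot atTop)
    (htop : Tendsto (fun t => (γ t).2) atTop atTop) :
    ∃ g : OnePoint (ℂ × ℝ) ≃ₜ OnePoint (ℂ × ℝ), IsOrientationPreserving g ∧
      g OnePoint.infty = OnePoint.infty ∧
      (∀ t, t ≤ a → g (γ t) = ((-1, (γ t).2) : ℂ × ℝ)) ∧
      (∀ t, b ≤ t → g (γ t) = ((1, (γ t).2) : ℂ × ℝ)) ∧
      ∀ w c, c ≤ M → g ((w, c) : ℂ × ℝ) = ((w, c) : ℂ × ℝ) := by
  obtain ⟨θ, hθ, hbθ, hθz, hzθ⟩ :=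
    exists_continuous_inverse_of_strictMonoOn_Ici (by fun_prop) hmono htop
  obtain ⟨ψ, hψ, haψ, hψz, hzψ⟩ := exists_continuous_inverse_of_strictMonoOn_Ici
    (z := fun t => (γ (-t)).2) (b := -a) (by fun_prop)
    (fun s hs t ht hst => hanti (Set.mem_Iic.2 (neg_le.1 ht)) (Set.mem_Iic.2 (neg_le.1 hs))
      (neg_lt_neg hst))
    (hbot.comp tendsto_neg_atTop_atBot)
  simp only [neg_neg, ha, hb] at hzθ hzψ
  have hdisjoint : ∀ c, (γ (θ c)).1 ≠ (γ (-ψ c)).1 := fun c h => by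
    have heq : θ c = -ψ c := hinj (Prod.ext h ((hzθ c).trans (hzψ c).symm))
    linarith [hbθ c, haψ c]
  have hθM : ∀ c ≤ M, θ c = b := fun c hc =>
    hmono.injOn (hbθ c) Set.self_mem_Ici (by simp [hzθ, hb, hc])
  have hψM : ∀ c ≤ M, -ψ c = a := fun c hc =>
    hanti.injOn (neg_le.1 (haψ c)) Set.self_mem_Iic (by simp [hzψ, ha, hc])
  obtain ⟨g, hg, hginf, hgθ, hgψ, hgw⟩ := exists_isOrientationPreserving_straighten
    (P := fun c => (γ (θ c)).1) (Q := fun c => (γ (-ψ c)).1) (by fun_prop) (by fun_prop)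
    hdisjoint (by simp [hθM 0 hM, hb]) (by simp [hψM 0 hM, ha])
  refine ⟨g, hg, hginf, fun t ht => ?_, fun t ht => ?_, fun w c hc => ?_⟩
  · have hψt : ψ (γ t).2 = -t := by simpa using hψz (-t) (neg_le_neg ht)
    simpa [hψt] using hgψ (γ t).2
  · simpa [hθz t ht] using hgθ (γ t).2
  · exact hgw w c (by simp [hθM c hc, hb]) (by simp [hψM c hc, ha])

/-- The closed curve `c` runs along the curve `κ` for times in `[a, b]`, and otherwise, from time
`b` through time `∞` to time `a`, along the segment from `κ b` to `κ a`. -/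
structure IsClosedBySegment {E : Type*} [AddCommGroup E] [Module ℝ E] (c : OnePoint ℝ → E)
    (κ : ℝ → E) (a b : ℝ) : Prop where
  eq_arc : ∀ t ∈ Set.Icc a b, c t = κ t
  exists_eq_lineMap : ∃ ℓ : OnePoint ℝ → ℝ, StrictAntiOn (fun t : ℝ => ℓ t) (Set.Iic a) ∧
    StrictAntiOn (fun t : ℝ => ℓ t) (Set.Ici b) ∧
    ∀ p ∉ ((↑) : ℝ → OnePoint ℝ) '' Set.Ioo a b, c p = AffineMap.lineMap (κ a) (κ b) (ℓ p)

theorem IsClosedBySegment.comp {E F : Type*} [AddCommGroup E] [Module ℝ E] [AddCommGroup F]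
    [Module ℝ F] {c : OnePoint ℝ → E} {κ : ℝ → E} {a b : ℝ} (h : IsClosedBySegment c κ a b)
    (f : E →ᵃ[ℝ] F) : IsClosedBySegment (f ∘ c) (f ∘ κ) a b where
  eq_arc t ht := congrArg f (h.eq_arc t ht)
  exists_eq_lineMap := by
    obtain ⟨ℓ, hℓa, hℓb, hℓ⟩ := h.exists_eq_lineMap
    exact ⟨ℓ, hℓa, hℓb, fun p hp => by simp [hℓ p hp]⟩

/-- The long curve `κ`, completed by `κ ∞ = ∞`, is carried by an orientation-preserving
homeomorphism of the sphere to a curve that keeps the arc of `κ` over `[a, b]` and replaces the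
rest, through `∞`, by a segment. -/
def ClosesBySegment {E : Type*} [NormedAddCommGroup E] [NormedSpace ℝ E] (κ : ℝ → E)
    (a b : ℝ) : Prop :=
  ∃ (g : OnePoint E ≃ₜ OnePoint E) (c : OnePoint ℝ → E), IsOrientationPreserving g ∧
    IsClosedBySegment c κ a b ∧ ∀ p, g (OnePoint.map κ p) = c p

theorem ClosesBySegment.of_comp {E F : Type*} [NormedAddCommGroup E] [NormedSpace ℝ E]
    [NormedAddCommGroup F] [NormedSpace ℝ F] {κ : ℝ → E} {a b : ℝ} (f : E ≃ᴬ[ℝ] F)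
    (h : ClosesBySegment (f ∘ κ) a b) : ClosesBySegment κ a b := by
  obtain ⟨g, c, hg, hc, hgc⟩ := h
  let e : OnePoint F ≃ₜ OnePoint E := f.symm.toHomeomorph.onePointCongr
  have he : ∀ y : F, e y = (f.symm y : OnePoint E) := fun _ => rfl
  have hesymm : ∀ p, e.symm (OnePoint.map κ p) = OnePoint.map (f ∘ κ) p := fun p => by
    cases p <;> rfl
  refine ⟨(e.symm.trans g).trans e, f.symm ∘ c, hg.conj e, ?_, fun p => ?_⟩
  · have hκ : f.symm ∘ f ∘ κ = κ := funext fun t => f.symm_apply_apply (κ t)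
    simpa [hκ] using! hc.comp (f.symm : F →ᵃ[ℝ] E)
  · simp only [Homeomorph.trans_apply, hesymm, hgc, he, Function.comp_apply]

theorem exists_isOrientationPreserving_foldTails {γ : ℝ → ℂ × ℝ} (hγ : Continuous γ)
    (hinj : Function.Injective γ) {a b M : ℝ} (hab : a < b) (hM : 1 ≤ M) (ha : γ a = (-1, M))
    (hb : γ b = (1, M)) (hanti : StrictAntiOn (fun t => (γ t).2) (Set.Iic a))
    (hmono : StrictMonoOn (fun t => (γ t).2) (Set.Ici b))
    (hbot : Tendsto (fun t => (γ t).2) atBot atTop)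
    (htop : Tendsto (fun t => (γ t).2) atTop atTop) (hlt : ∀ t ∈ Set.Ioo a b, (γ t).2 < M)
    (hpos : ∀ t ∈ Set.Icc a b, 0 < (γ t).2)
    (hsq : ∀ t ∈ Set.Icc a b, ‖(γ t).1‖ ^ 2 ≤ (γ t).2) :
    ∃ g : OnePoint (ℂ × ℝ) ≃ₜ OnePoint (ℂ × ℝ), IsOrientationPreserving g ∧
      g OnePoint.infty = ((0, M) : ℂ × ℝ) ∧
      (∀ t ∈ Set.Icc a b, g (γ t) = (γ t : OnePoint (ℂ × ℝ))) ∧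
      (∀ t, t ≤ a → g (γ t) = (((M / (γ t).2) • (-1), M) : ℂ × ℝ)) ∧
      ∀ t, b ≤ t → g (γ t) = (((M / (γ t).2) • 1, M) : ℂ × ℝ) := by
  have hcases : ∀ t ∈ Set.Icc a b, t ∈ Set.Ioo a b ∨ t = a ∨ t = b := fun t ht => by
    rcases Set.eq_endpoints_or_mem_Ioo_of_mem_Icc ht with h | h | h <;> simp [h]
  have hle : ∀ t ∈ Set.Icc a b, (γ t).2 ≤ M := fun t ht => by
    rcases hcases t ht with h | rfl | rfl
    exacts [(hlt t h).le, by simp [ha], by simp [hb]]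
  have hnorm : ∀ t ∈ Set.Icc a b, (γ t).2 = M → ‖(γ t).1‖ = 1 := fun t ht htM => by
    rcases hcases t ht with h | rfl | rfl
    exacts [absurd htM (hlt t h).ne, by simp [ha], by simp [hb]]
  obtain ⟨f, hf, hfinf, hfa, hfb, hfM⟩ := exists_isOrientationPreserving_straighten_tails hγ hinj
    hab (zero_le_one.trans hM) ha hb hanti hmono hbot htop
  obtain ⟨g, hg, hgarc, hgray, hginf⟩ := exists_isOrientationPreserving_foldRays
    (isCompact_Icc.image hγ) ((Set.nonempty_Icc.2 hab.le).image γ) hM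
    (Set.forall_mem_image.2 hpos) (Set.forall_mem_image.2 hsq)
    (Set.forall_mem_image.2 hle) (Set.forall_mem_image.2 hnorm)
  refine ⟨f.trans g, hf.trans hg, ?_, fun t ht => ?_, fun t ht => ?_, fun t ht => ?_⟩ <;>
    simp only [Homeomorph.trans_apply]
  · rw [hfinf, hginf]
  · rw [hfM _ _ (hle t ht), hgarc _ ⟨t, ht, rfl⟩]
  · rw [hfa t ht, hgray _ _ (by simp)]
    simpa [ha] using hanti.antitoneOn ht Set.self_mem_Iic ht
  · rw [hfb t ht, hgray _ _ (by simp)]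
    simpa [hb] using hmono.monotoneOn Set.self_mem_Ici ht ht

theorem isClosedBySegment_of_eq_div_height {c : OnePoint ℝ → ℂ × ℝ} {κ : ℝ → ℂ × ℝ}
    {a b M : ℝ} (hab : a < b) (hM : 0 < M) (ha : κ a = (-1, M)) (hb : κ b = (1, M))
    (hanti : StrictAntiOn (fun t => (κ t).2) (Set.Iic a))
    (hmono : StrictMonoOn (fun t => (κ t).2) (Set.Ici b)) (hc : ∀ t ∈ Set.Icc a b, c t = κ t)
    (hca : ∀ t : ℝ, t ≤ a → c t = ((M / (κ t).2) • (-1), M))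
    (hcb : ∀ t : ℝ, b ≤ t → c t = ((M / (κ t).2) • 1, M)) (hcinf : c OnePoint.infty = (0, M)) :
    IsClosedBySegment c κ a b := by
  have hline : ∀ r : ℝ, AffineMap.lineMap (κ a) (κ b) ((1 + r) / 2) = (r • (1 : ℂ), M) := by
    intro r
    rw [ha, hb, AffineMap.lineMap_apply]
    ext <;> simp
  have haM : ∀ t ≤ a, M ≤ (κ t).2 := fun t ht => by
    simpa [ha] using hanti.antitoneOn ht Set.self_mem_Iic ht
  have hbM : ∀ t ≥ b, M ≤ (κ t).2 := fun t ht => by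
    simpa [hb] using hmono.monotoneOn Set.self_mem_Ici ht ht
  refine ⟨hc, fun p => p.elim (1 / 2) fun t => (1 + (if t ≤ a then -1 else 1) * (M / (κ t).2)) / 2,
    fun s hs t ht hst => ?_, fun s hs t ht hst => ?_, fun p hp => ?_⟩
  · have := div_lt_div_of_pos_left hM (hM.trans_le (haM t ht)) (hanti hs ht hst)
    simp only [OnePoint.elim_some, if_pos (Set.mem_Iic.1 hs), if_pos (Set.mem_Iic.1 ht)]
    linarith
  · have := div_lt_div_of_pos_left hM (hM.trans_le (hbM s hs)) (hmono hs ht hst)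
    simp only [OnePoint.elim_some, if_neg (hab.trans_le hs).not_ge, if_neg (hab.trans_le ht).not_ge]
    linarith
  · induction p with
    | infty => simpa [hcinf] using (hline 0).symm
    | coe t =>
      rcases le_or_gt t a with hta | hta
      · simp only [OnePoint.elim_some, if_pos hta, hline, hca t hta]
        simp
      · have htb : b ≤ t := not_lt.1 fun h => hp ⟨t, ⟨hta, h⟩, rfl⟩
        simp only [OnePoint.elim_some, if_neg hta.not_ge, hline, hcb t htb, one_mul]

theorem closesBySegment_of_height_lt {γ : ℝ → ℂ × ℝ} (hγ : Continuous γ)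
    (hinj : Function.Injective γ) {a b M : ℝ} (hab : a < b) (hM : 1 ≤ M) (ha : γ a = (-1, M))
    (hb : γ b = (1, M)) (hanti : StrictAntiOn (fun t => (γ t).2) (Set.Iic a))
    (hmono : StrictMonoOn (fun t => (γ t).2) (Set.Ici b))
    (hbot : Tendsto (fun t => (γ t).2) atBot atTop)
    (htop : Tendsto (fun t => (γ t).2) atTop atTop) (hlt : ∀ t ∈ Set.Ioo a b, (γ t).2 < M)
    (hpos : ∀ t ∈ Set.Icc a b, 0 < (γ t).2)
    (hsq : ∀ t ∈ Set.Icc a b, ‖(γ t).1‖ ^ 2 ≤ (γ t).2) :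
    ClosesBySegment γ a b := by
  obtain ⟨g, hg, hginf, hgarc, hga, hgb⟩ := exists_isOrientationPreserving_foldTails hγ hinj hab hM
    ha hb hanti hmono hbot htop hlt hpos hsq
  have hfinite : ∀ p, ∃ y : ℂ × ℝ, g (OnePoint.map γ p) = y := fun p => by
    induction p with
    | infty => exact ⟨_, hginf⟩
    | coe t =>
      rcases le_or_gt t a with hta | hta
      · exact ⟨_, hga t hta⟩
      · rcases le_total t b with htb | htb
        exacts [⟨_, hgarc t ⟨hta.le, htb⟩⟩, ⟨_, hgb t htb⟩]
  choose c hc using hfinite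
  refine ⟨g, c, hg, isClosedBySegment_of_eq_div_height hab (one_pos.trans_le hM) ha hb hanti hmono
    (fun t ht => ?_) (fun t ht => ?_) (fun t ht => ?_) ?_, hc⟩ <;>
    rw [← OnePoint.coe_eq_coe, ← hc]
  exacts [hgarc t ht, hga t ht, hgb t ht, hginf]

theorem closesBySegment_of_height_neg {γ : ℝ → ℂ × ℝ} (hγ : Continuous γ)
    (hinj : Function.Injective γ) {a b : ℝ} (hab : a < b) (ha : γ a = (-1, 0)) (hb : γ b = (1, 0))
    (hanti : StrictAntiOn (fun t => (γ t).2) (Set.Iic a))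
    (hmono : StrictMonoOn (fun t => (γ t).2) (Set.Ici b))
    (hbot : Tendsto (fun t => (γ t).2) atBot atTop)
    (htop : Tendsto (fun t => (γ t).2) atTop atTop) (hneg : ∀ t ∈ Set.Ioo a b, (γ t).2 < 0) :
    ClosesBySegment γ a b := by
  obtain ⟨M, hM⟩ : ∃ M, ∀ t ∈ Set.Icc a b, ‖(γ t).1‖ ^ 2 + 1 - (γ t).2 ≤ M := by
    obtain ⟨M, hM⟩ := (isCompact_Icc (a := a) (b := b)).bddAbove_image
      (f := fun t => ‖(γ t).1‖ ^ 2 + 1 - (γ t).2) (by fun_prop)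
    exact ⟨M, fun t ht => hM ⟨t, ht, rfl⟩⟩
  have hM₂ : 2 ≤ M := by simpa [ha, one_add_one_eq_two] using hM a (Set.left_mem_Icc.2 hab.le)
  let f : ℂ × ℝ ≃ᴬ[ℝ] ℂ × ℝ := ContinuousAffineEquiv.constVAdd ℝ (ℂ × ℝ) (0, M)
  have hf : ∀ t, f (γ t) = ((γ t).1, M + (γ t).2) := fun t => Prod.ext (zero_add _) rfl
  refine .of_comp f (closesBySegment_of_height_lt (M := M) (f.continuous.comp hγ)
    (f.injective.comp hinj) hab (one_le_two.trans hM₂) ?_ ?_ ?_ ?_ ?_ ?_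
    (fun t ht => ?_) (fun t ht => ?_) fun t ht => ?_) <;> simp only [Function.comp_apply, hf]
  · simp [ha]
  · simp [hb]
  · exact hanti.const_add M
  · exact hmono.const_add M
  · exact tendsto_atTop_add_const_left _ M hbot
  · exact tendsto_atTop_add_const_left _ M htop
  · linarith [hneg t ht]
  · nlinarith [hM t ht]
  · linarith [hM t ht]

/-- Linear coordinates on `ℝ³` with values in `ℂ × ℝ`, in which the `i`-th coordinate is the height
and the two other coordinates form the horizontal component. -/
noncomputable def heightCoordinates (i : Fin 3) : Euc 3 ≃ₗ[ℝ] ℂ × ℝ where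
  toFun x := (⟨x (i + 1), x (i + 2)⟩, x i)
  map_add' x y := by refine Prod.ext (Complex.ext ?_ ?_) ?_ <;> simp
  map_smul' r x := by refine Prod.ext (Complex.ext ?_ ?_) ?_ <;> simp
  invFun p := WithLp.toLp 2 fun j => if j = i then p.2 else if j = i + 1 then p.1.re else p.1.im
  left_inv x := by
    ext j
    fin_cases i <;> fin_cases j <;> rfl
  right_inv p := by
    refine Prod.ext (Complex.ext ?_ ?_) ?_ <;> fin_cases i <;> rfl

theorem exists_continuousAffineEquiv_normalizing {x y : Euc 3} (hxy : x ≠ y) {i : Fin 3}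
    (hi : x i = y i) {s : ℝ} (hs : s ≠ 0) :
    ∃ f : Euc 3 ≃ᴬ[ℝ] ℂ × ℝ, f x = (-1, 0) ∧ f y = (1, 0) ∧ ∀ z, (f z).2 = s * z i - s * x i := by
  let L : Euc 3 ≃ₗ[ℝ] ℂ × ℝ := heightCoordinates i
  have hne : (L y).1 - (L x).1 ≠ 0 := fun h =>
    hxy (L.injective (Prod.ext (sub_eq_zero.1 h).symm hi))
  let Λ : Euc 3 ≃ₗ[ℝ] ℂ × ℝ := L.trans <|
    ((LinearEquiv.smulOfNeZero ℂ ℂ (2 / ((L y).1 - (L x).1))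
      (div_ne_zero two_ne_zero hne)).restrictScalars ℝ).prodCongr
      (LinearEquiv.smulOfNeZero ℝ ℝ s hs)
  let f : Euc 3 ≃ᴬ[ℝ] ℂ × ℝ := Λ.toContinuousLinearEquiv.toContinuousAffineEquiv.trans <|
    ContinuousAffineEquiv.constVAdd ℝ (ℂ × ℝ)
      (-(((L y).1 + (L x).1) / ((L y).1 - (L x).1)), -(s * x i))
  have hf : ∀ z, f z = (-(((L y).1 + (L x).1) / ((L y).1 - (L x).1)) +
      2 / ((L y).1 - (L x).1) * (L z).1, -(s * x i) + s * z i) := fun z => rfl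
  refine ⟨f, ?_, ?_, fun z => ?_⟩ <;> rw [hf]
  · refine Prod.ext ?_ (neg_add_cancel _)
    field
  · refine Prod.ext ?_ (by rw [hi, neg_add_cancel])
    field
  · exact neg_add_eq_sub _ _

theorem closesBySegment_of_coord_lt {κ : ℝ → Euc 3} (hκ : Continuous κ)
    (hinj : Function.Injective κ) {i : Fin 3} {s : ℝ} (hs : s ≠ 0) {a b : ℝ} (hab : a < b)
    (hi : κ a i = κ b i) (hanti : StrictAntiOn (fun t => s * κ t i) (Set.Iic a))
    (hmono : StrictMonoOn (fun t => s * κ t i) (Set.Ici b))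
    (hbot : Tendsto (fun t => s * κ t i) atBot atTop)
    (htop : Tendsto (fun t => s * κ t i) atTop atTop)
    (hlt : ∀ t ∈ Set.Ioo a b, s * κ t i < s * κ a i) : ClosesBySegment κ a b := by
  obtain ⟨f, hfa, hfb, hf⟩ := exists_continuousAffineEquiv_normalizing (hinj.ne hab.ne) hi hs
  refine .of_comp f (closesBySegment_of_height_neg (f.continuous.comp hκ)
    (f.injective.comp hinj) hab hfa hfb ?_ ?_ ?_ ?_ fun t ht => ?_) <;>
    simp only [Function.comp_apply, hf, sub_eq_add_neg]
  · exact hanti.add_const _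
  · exact hmono.add_const _
  · exact tendsto_atTop_add_const_right _ _ hbot
  · exact tendsto_atTop_add_const_right _ _ htop
  · linarith [hlt t ht]

/-! ## Counting local maxima -/

section LocalMaxima

variable {X : Type*} [TopologicalSpace X] {h : X → ℝ} {C C' : Set X} {x : X}

theorem isLocalMax_of_mem_localMaxima (hC : C ∈ localMaxima h) (hx : x ∈ C) : IsLocalMax h x := by
  obtain ⟨y, -, hy⟩ := hC
  exact hy x hx

theorem nonempty_of_mem_localMaxima (hC : C ∈ localMaxima h) : C.Nonempty := by
  obtain ⟨y, rfl, -⟩ := hC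
  exact ⟨y, mem_connectedComponentIn rfl⟩

theorem eq_connectedComponentIn_of_mem_localMaxima (hC : C ∈ localMaxima h) (hx : x ∈ C) :
    C = connectedComponentIn {y | h y = h x} x := by
  obtain ⟨y, rfl, -⟩ := hC
  have hxy : h x = h y := connectedComponentIn_subset {z | h z = h y} y hx
  rw [hxy]
  exact connectedComponentIn_eq hx

theorem eq_of_mem_of_mem_localMaxima (hC : C ∈ localMaxima h) (hC' : C' ∈ localMaxima h)
    (hx : x ∈ C) (hx' : x ∈ C') : C = C' := by
  rw [eq_connectedComponentIn_of_mem_localMaxima hC hx,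
    eq_connectedComponentIn_of_mem_localMaxima hC' hx']

theorem subset_of_mem_localMaxima_of_isPreconnected (hC : C ∈ localMaxima h) (hx : x ∈ C)
    {A : Set X} (hA : IsPreconnected A) (hxA : x ∈ A) (hconst : ∀ y ∈ A, h y = h x) : A ⊆ C := by
  rw [eq_connectedComponentIn_of_mem_localMaxima hC hx]
  exact hA.subset_connectedComponentIn hxA hconst

end LocalMaxima

theorem not_isLocalMax_of_strictAntiOn {α β : Type*} [TopologicalSpace α] [Preorder α]
    [Preorder β] {f : α → β} {s : Set α} {t : α} [(𝓝[<] t).NeBot] (hf : StrictAntiOn f s)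
    (ht : t ∈ s) (hs : s ∈ 𝓝[<] t) : ¬ IsLocalMax f t := fun hmax => by
  obtain ⟨u, ⟨hut, hu⟩, hlt⟩ := (((hmax.filter_mono nhdsWithin_le_nhds :
    ∀ᶠ u in 𝓝[<] t, f u ≤ f t).and hs).and self_mem_nhdsWithin).exists
  exact (hf hu ht hlt).not_ge hut

theorem not_isLocalMax_of_strictMonoOn {α β : Type*} [TopologicalSpace α] [Preorder α]
    [Preorder β] {f : α → β} {s : Set α} {t : α} [(𝓝[>] t).NeBot] (hf : StrictMonoOn f s)
    (ht : t ∈ s) (hs : s ∈ 𝓝[>] t) : ¬ IsLocalMax f t := fun hmax => by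
  obtain ⟨u, ⟨hut, hu⟩, hlt⟩ := (((hmax.filter_mono nhdsWithin_le_nhds :
    ∀ᶠ u in 𝓝[>] t, f u ≤ f t).and hs).and self_mem_nhdsWithin).exists
  exact (hf ht hu hlt).not_ge hut

theorem tendsto_onePoint_coe_atTop :
    Tendsto (fun t : ℝ => (t : OnePoint ℝ)) atTop (𝓝 OnePoint.infty) :=
  OnePoint.tendsto_coe_infty.mono_left (coclosedCompact_eq_cocompact (X := ℝ) ▸ atTop_le_cocompact)

theorem tendsto_onePoint_coe_atBot :
    Tendsto (fun t : ℝ => (t : OnePoint ℝ)) atBot (𝓝 OnePoint.infty) :=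
  OnePoint.tendsto_coe_infty.mono_left (coclosedCompact_eq_cocompact (X := ℝ) ▸ atBot_le_cocompact)

theorem isPreconnected_compl_coe_image_Ioo (a b : ℝ) :
    IsPreconnected (((↑) : ℝ → OnePoint ℝ) '' Set.Ioo a b)ᶜ := by
  have htail : ∀ {l : Filter ℝ} {s : Set ℝ} [l.NeBot],
      Tendsto (fun t : ℝ => (t : OnePoint ℝ)) l (𝓝 OnePoint.infty) → s ∈ l → IsPreconnected s →
      IsPreconnected (insert OnePoint.infty (((↑) : ℝ → OnePoint ℝ) '' s)) :=
    fun hl hsl hs => (hs.image _ OnePoint.continuous_coe.continuousOn).subset_closure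
      (Set.subset_insert _ _) (Set.insert_subset (mem_closure_of_tendsto hl
        (mem_of_superset hsl fun t ht => ⟨t, ht, rfl⟩)) subset_closure)
  have hunion := (htail tendsto_onePoint_coe_atBot (Iic_mem_atBot a) isPreconnected_Iic).union
    OnePoint.infty (Set.mem_insert _ _) (Set.mem_insert _ _)
    (htail tendsto_onePoint_coe_atTop (Ici_mem_atTop b) isPreconnected_Ici)
  convert hunion using 1
  ext p
  cases p with
  | infty => simp
  | coe t => simp [imp_iff_not_or]

section Tails

variable {h : OnePoint ℝ → ℝ} {a b : ℝ} {p : OnePoint ℝ}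

theorem eq_coe_of_isLocalMax_of_strictAntiOn_tails (hh : Continuous h)
    (ha : StrictAntiOn (fun t : ℝ => h t) (Set.Iic a))
    (hb : StrictAntiOn (fun t : ℝ => h t) (Set.Ici b))
    (hp : p ∉ ((↑) : ℝ → OnePoint ℝ) '' Set.Ioo a b) (hmax : IsLocalMax h p) : p = b := by
  cases p with
  | infty =>
    have hlim := (hh.tendsto OnePoint.infty).comp tendsto_onePoint_coe_atTop
    obtain ⟨t, hle, ht⟩ :=
      ((tendsto_onePoint_coe_atTop.eventually hmax).and (eventually_ge_atTop b)).exists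
    have hge : h OnePoint.infty ≤ h ↑(t + 1) := le_of_tendsto hlim <| by
      filter_upwards [eventually_ge_atTop (t + 1)] with s hs
      exact hb.antitoneOn (by grind) (by grind) hs
    exact absurd (hb ht (by grind) (lt_add_one t)) (hle.trans hge).not_gt
  | coe t =>
    have hmax' : IsLocalMax (fun s : ℝ => h s) t :=
      (OnePoint.continuous_coe.tendsto t).eventually hmax
    rcases le_or_gt t a with hta | hta
    · exact absurd hmax' (not_isLocalMax_of_strictAntiOn ha hta
        (mem_of_superset self_mem_nhdsWithin fun s hs => (le_of_lt hs).trans hta))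
    · have htb : b ≤ t := not_lt.1 fun htb => hp ⟨t, ⟨hta, htb⟩, rfl⟩
      refine congrArg _ (htb.eq_or_lt.resolve_right fun hbt => ?_).symm
      exact not_isLocalMax_of_strictAntiOn hb htb
        (mem_nhdsWithin_of_mem_nhds (Ici_mem_nhds hbt)) hmax'

theorem eq_coe_of_isLocalMax_of_strictMonoOn_tails (hh : Continuous h)
    (ha : StrictMonoOn (fun t : ℝ => h t) (Set.Iic a))
    (hb : StrictMonoOn (fun t : ℝ => h t) (Set.Ici b))
    (hp : p ∉ ((↑) : ℝ → OnePoint ℝ) '' Set.Ioo a b) (hmax : IsLocalMax h p) : p = a := by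
  cases p with
  | infty =>
    have hlim := (hh.tendsto OnePoint.infty).comp tendsto_onePoint_coe_atBot
    obtain ⟨t, hle, ht⟩ :=
      ((tendsto_onePoint_coe_atBot.eventually hmax).and (eventually_le_atBot a)).exists
    have hge : h OnePoint.infty ≤ h ↑(t - 1) := le_of_tendsto hlim <| by
      filter_upwards [eventually_le_atBot (t - 1)] with s hs
      exact ha.monotoneOn (by grind) (by grind) hs
    exact absurd (ha (by grind) ht (sub_one_lt t)) (hle.trans hge).not_gt
  | coe t =>
    have hmax' : IsLocalMax (fun s : ℝ => h s) t :=
      (OnePoint.continuous_coe.tendsto t).eventually hmax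
    rcases le_or_gt b t with htb | htb
    · exact absurd hmax' (not_isLocalMax_of_strictMonoOn hb htb
        (mem_of_superset self_mem_nhdsWithin fun s hs => htb.trans (le_of_lt hs)))
    · have hta : t ≤ a := not_lt.1 fun hat => hp ⟨t, ⟨hat, htb⟩, rfl⟩
      refine congrArg _ (hta.eq_or_lt.resolve_right fun hat => ?_)
      exact not_isLocalMax_of_strictMonoOn ha hta
        (mem_nhdsWithin_of_mem_nhds (Iic_mem_nhds hat)) hmax'

end Tails

theorem exists_derivative_eval_eq_zero_of_isLocalMaxOn {P : Polynomial ℝ} {x y : ℝ} (hxy : x < y)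
    (hx : IsLocalMaxOn P.eval (Set.Icc x y) x) (hy : IsLocalMaxOn P.eval (Set.Icc x y) y) :
    ∃ s ∈ Set.Ioo x y, P.derivative.eval s = 0 := by
  have hIoo : ∀ {t : ℝ} {l : Filter ℝ} [l.NeBot], IsLocalMaxOn P.eval (Set.Icc x y) t → l ≤ 𝓝 t →
      Set.Ioo x y ∈ l → ∃ s ∈ Set.Ioo x y, P.eval s ≤ P.eval t := fun ht hl hmem => by
    have hle := (eventually_nhdsWithin_iff.1 ht).filter_mono hl
    obtain ⟨s, hst, hs⟩ := (hle.and hmem).exists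
    exact ⟨s, hs, hst (Set.Ioo_subset_Icc_self hs)⟩
  obtain ⟨u, hu, hmin⟩ := isCompact_Icc.exists_isMinOn (Set.nonempty_Icc.2 hxy.le)
    P.continuous.continuousOn
  obtain ⟨s, hs, hsu⟩ : ∃ s ∈ Set.Ioo x y, P.eval s ≤ P.eval u := by
    rcases Set.eq_endpoints_or_mem_Ioo_of_mem_Icc hu with rfl | rfl | hu
    · exact hIoo hx nhdsWithin_le_nhds (Ioo_mem_nhdsGT hxy)
    · exact hIoo hy nhdsWithin_le_nhds (Ioo_mem_nhdsLT hxy)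
    · exact ⟨u, hu, le_rfl⟩
  have hlocal : IsLocalMin P.eval s := by
    filter_upwards [Icc_mem_nhds hs.1 hs.2] with v hv using hsu.trans (hmin hv)
  exact ⟨s, hs, P.deriv ▸ hlocal.deriv_eq_zero⟩

theorem two_mul_card_le_of_isLocalMaxOn_eval {P : Polynomial ℝ} (hP : P.derivative ≠ 0) {a b : ℝ}
    {S : Finset ℝ} (hS : ∀ t ∈ S, t ∈ Set.Icc a b ∧ IsLocalMaxOn P.eval (Set.Icc a b) t)
    (hends : a ∈ S → b ∉ S) : 2 * S.card ≤ P.natDegree + 1 := by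
  set R := P.derivative.roots.toFinset
  have hR : ∀ {t}, t ∈ R ↔ P.derivative.eval t = 0 := by
    simp [R, Polynomial.mem_roots hP]
  have hRcard : R.card ≤ P.natDegree - 1 := (Multiset.toFinset_card_le _).trans
    ((Polynomial.card_roots' _).trans (Polynomial.natDegree_derivative_le P))
  have hPdeg : P.natDegree ≠ 0 := fun h => hP (Polynomial.derivative_eq_zero.2 h)
  have hbetween : S.card ≤ (R \ S).card + 1 := by
    refine Finset.card_le_sdiff_of_interleaved fun x hx y hy hxy _ => ?_
    have hsub : Set.Icc x y ⊆ Set.Icc a b := Set.Icc_subset_Icc (hS x hx).1.1 (hS y hy).1.2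
    obtain ⟨s, hs, hs₀⟩ := exists_derivative_eval_eq_zero_of_isLocalMaxOn hxy
      ((hS x hx).2.on_subset hsub) ((hS y hy).2.on_subset hsub)
    exact ⟨s, hR.2 hs₀, hs⟩
  have hendpoint : ∀ t ∈ S \ R, t = a ∨ t = b := fun t ht => by
    obtain ⟨htS, htR⟩ := Finset.mem_sdiff.1 ht
    rcases Set.eq_endpoints_or_mem_Ioo_of_mem_Icc (hS t htS).1 with hta | htb | ht
    · exact .inl hta
    · exact .inr htb
    · have hlocal := (hS t htS).2.isLocalMax (Icc_mem_nhds ht.1 ht.2)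
      exact absurd (hR.2 (P.deriv ▸ hlocal.deriv_eq_zero)) htR
  have hSR : (S \ R).card ≤ 1 := Finset.card_le_one.2 fun x hx y hy => by
    rcases hendpoint x hx with rfl | rfl <;> rcases hendpoint y hy with rfl | rfl <;> grind
  have hdisjoint := Finset.card_sdiff_add_card_inter S R
  have hdisjoint' := Finset.card_sdiff_add_card_inter R S
  rw [Finset.inter_comm] at hdisjoint'
  omega

theorem encard_le_of_isLocalMaxOn_eval {P : Polynomial ℝ} (hP : P.derivative ≠ 0) {m : ℕ}
    (hdeg : P.natDegree ≤ 2 * m) {a b : ℝ} {S : Set ℝ}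
    (hS : ∀ t ∈ S, t ∈ Set.Icc a b ∧ IsLocalMaxOn P.eval (Set.Icc a b) t)
    (hends : a ∈ S → b ∉ S) : S.encard ≤ m := by
  by_contra! hlt
  obtain ⟨F, hFS, hF⟩ := Set.exists_subset_encard_eq (Order.add_one_le_of_lt hlt)
  lift F to Finset ℝ using Set.finite_of_encard_eq_coe (k := m + 1) (by simpa using hF)
  rw [Set.encard_coe_eq_coe_finsetCard] at hF
  have hcard : F.card = m + 1 := by exact_mod_cast hF
  have := two_mul_card_le_of_isLocalMaxOn_eval hP (fun t ht => hS t (hFS ht))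
    (fun ha hb => hends (hFS ha) (hFS hb))
  omega

theorem isLocalMaxOn_of_isLocalMax_coe {h : OnePoint ℝ → ℝ} {f : ℝ → ℝ} {s : Set ℝ}
    (hf : ∀ t ∈ s, h t = f t) {t : ℝ} (ht : t ∈ s) (hmax : IsLocalMax h (t : OnePoint ℝ)) :
    IsLocalMaxOn f s t := by
  filter_upwards [((OnePoint.continuous_coe.tendsto t).eventually hmax).filter_mono
    nhdsWithin_le_nhds, self_mem_nhdsWithin] with u hu hus
  rwa [← hf t ht, ← hf u hus]

section PolynomialArc

variable {h : OnePoint ℝ → ℝ} {P : Polynomial ℝ} {m : ℕ} {a b : ℝ}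

theorem encard_localMaxima_le_of_representatives (hm : 1 ≤ m) (hdeg : P.natDegree ≤ 2 * m)
    (hab : a < b) (harc : ∀ t ∈ Set.Icc a b, h t = P.eval t)
    (hrep : ∀ C ∈ localMaxima h, ∃ t ∈ Set.Icc a b, (t : OnePoint ℝ) ∈ C)
    (hends : ∀ C ∈ localMaxima h, ∀ C' ∈ localMaxima h, ↑a ∈ C → ↑b ∈ C' → C = C') :
    (localMaxima h).encard ≤ m := by
  by_cases hP : P.derivative = 0
  · have hconst : ∀ s ∈ Set.Icc a b, ∀ t ∈ Set.Icc a b, h s = h t := fun s hs t ht => by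
      rw [harc s hs, harc t ht,
        Polynomial.eq_C_of_natDegree_eq_zero (Polynomial.derivative_eq_zero.1 hP)]
      simp
    have ha : ∀ C ∈ localMaxima h, (a : OnePoint ℝ) ∈ C := fun C hC => by
      obtain ⟨t, ht, htC⟩ := hrep C hC
      exact subset_of_mem_localMaxima_of_isPreconnected hC htC
        (isPreconnected_Icc.image _ OnePoint.continuous_coe.continuousOn) ⟨t, ht, rfl⟩
        (Set.forall_mem_image.2 fun s hs => hconst s hs t ht) ⟨a, Set.left_mem_Icc.2 hab.le, rfl⟩
    calc (localMaxima h).encard ≤ 1 := Set.encard_le_one_iff.2 fun C C' hC hC' =>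
          eq_of_mem_of_mem_localMaxima hC hC' (ha C hC) (ha C' hC')
      _ ≤ m := mod_cast hm
  · choose! ρ hρ hρC using hrep
    have hinj : Set.InjOn ρ (localMaxima h) := fun C hC C' hC' hCC' =>
      eq_of_mem_of_mem_localMaxima hC hC' (hρC C hC) (hCC' ▸ hρC C' hC')
    rw [← hinj.encard_image]
    refine encard_le_of_isLocalMaxOn_eval hP hdeg (Set.forall_mem_image.2 fun C hC =>
      ⟨hρ C hC, isLocalMaxOn_of_isLocalMax_coe harc (hρ C hC)
        (isLocalMax_of_mem_localMaxima hC (hρC C hC))⟩) ?_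
    rintro ⟨C, hC, hCa⟩ ⟨C', hC', hCb⟩
    have hCC' : C = C' := hends C hC C' hC' (hCa ▸ hρC C hC) (hCb ▸ hρC C' hC')
    exact hab.ne (by rw [← hCa, ← hCb, hCC'])

theorem encard_localMaxima_le_of_const_tails (hm : 1 ≤ m) (hdeg : P.natDegree ≤ 2 * m)
    (hab : a < b) (harc : ∀ t ∈ Set.Icc a b, h t = P.eval t)
    (hconst : ∀ p ∉ ((↑) : ℝ → OnePoint ℝ) '' Set.Ioo a b, h p = h b) :
    (localMaxima h).encard ≤ m := by
  set tails : Set (OnePoint ℝ) := (((↑) : ℝ → OnePoint ℝ) '' Set.Ioo a b)ᶜ with htails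
  have haT : (a : OnePoint ℝ) ∈ tails := by simp [htails]
  have hbT : (b : OnePoint ℝ) ∈ tails := by simp [htails]
  have hsub : ∀ C ∈ localMaxima h, ∀ p ∈ C, p ∈ tails → tails ⊆ C := fun C hC p hpC hp =>
    subset_of_mem_localMaxima_of_isPreconnected hC hpC (isPreconnected_compl_coe_image_Ioo a b) hp
      fun q hq => (hconst q hq).trans (hconst p hp).symm
  refine encard_localMaxima_le_of_representatives hm hdeg hab harc (fun C hC => ?_)
    fun C hC C' hC' ha hb => eq_of_mem_of_mem_localMaxima hC hC' (hsub C hC _ ha haT hbT) hb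
  obtain ⟨p, hp⟩ := nonempty_of_mem_localMaxima hC
  by_cases hpT : p ∈ tails
  · exact ⟨b, Set.right_mem_Icc.2 hab.le, hsub C hC p hp hpT hbT⟩
  · obtain ⟨t, ht, rfl⟩ := not_not.1 hpT
    exact ⟨t, Set.Ioo_subset_Icc_self ht, hp⟩

theorem encard_localMaxima_le_of_unique_isLocalMax_tails (hm : 1 ≤ m)
    (hdeg : P.natDegree ≤ 2 * m) (hab : a < b) (harc : ∀ t ∈ Set.Icc a b, h t = P.eval t) {e : ℝ}
    (he : e ∈ Set.Icc a b)
    (hmax : ∀ p ∉ ((↑) : ℝ → OnePoint ℝ) '' Set.Ioo a b, IsLocalMax h p → p = e) :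
    (localMaxima h).encard ≤ m := by
  refine encard_localMaxima_le_of_representatives hm hdeg hab harc (fun C hC => ?_)
    fun C hC C' hC' ha hb => ?_
  · obtain ⟨p, hp⟩ := nonempty_of_mem_localMaxima hC
    by_cases hpT : p ∈ ((↑) : ℝ → OnePoint ℝ) '' Set.Ioo a b
    · obtain ⟨t, ht, rfl⟩ := hpT
      exact ⟨t, Set.Ioo_subset_Icc_self ht, hp⟩
    · exact ⟨e, he, hmax p hpT (isLocalMax_of_mem_localMaxima hC hp) ▸ hp⟩
  · have hae := hmax a (by simp) (isLocalMax_of_mem_localMaxima hC ha)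
    have hbe := hmax b (by simp) (isLocalMax_of_mem_localMaxima hC' hb)
    exact absurd (OnePoint.coe_injective (hae.trans hbe.symm)) hab.ne

theorem IsClosedBySegment.encard_localMaxima_le
    (hc : IsClosedBySegment h (fun t => P.eval t) a b) (hh : Continuous h) (hm : 1 ≤ m)
    (hdeg : P.natDegree ≤ 2 * m) (hab : a < b) : (localMaxima h).encard ≤ m := by
  obtain ⟨ℓ, hℓa, hℓb, hℓ⟩ := hc.exists_eq_lineMap
  have ha : ∀ t ∈ Set.Iic a, h t = ℓ t * (P.eval b - P.eval a) + P.eval a := fun t ht => by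
    rw [hℓ t (by simp [(Set.mem_Iic.1 ht).not_gt]), AffineMap.lineMap_apply_ring']
  have hb : ∀ t ∈ Set.Ici b, h t = ℓ t * (P.eval b - P.eval a) + P.eval a := fun t ht => by
    rw [hℓ t (by simp [(Set.mem_Ici.1 ht).not_gt]), AffineMap.lineMap_apply_ring']
  rcases lt_trichotomy (P.eval a) (P.eval b) with hlt | heq | hlt
  · refine encard_localMaxima_le_of_unique_isLocalMax_tails hm hdeg hab hc.eq_arc
      (Set.right_mem_Icc.2 hab.le) fun p => eq_coe_of_isLocalMax_of_strictAntiOn_tails hh ?_ ?_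
    · intro s hs t ht hst
      simpa [ha s hs, ha t ht, hlt] using hℓa hs ht hst
    · intro s hs t ht hst
      simpa [hb s hs, hb t ht, hlt] using hℓb hs ht hst
  · refine encard_localMaxima_le_of_const_tails hm hdeg hab hc.eq_arc fun p hp => ?_
    rw [hℓ p hp, hℓ b (by simp)]
    simp [heq]
  · refine encard_localMaxima_le_of_unique_isLocalMax_tails hm hdeg hab hc.eq_arc
      (Set.left_mem_Icc.2 hab.le) fun p => eq_coe_of_isLocalMax_of_strictMonoOn_tails hh ?_ ?_
    · intro s hs t ht hst
      simpa [ha s hs, ha t ht, hlt] using hℓa hs ht hst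
    · intro s hs t ht hst
      simpa [hb s hs, hb t ht, hlt] using hℓb hs ht hst

end PolynomialArc

/-! ## Knots of even degree -/

/-- The curve in `ℝⁿ` whose coordinates are the polynomials `p i`. It need be neither injective nor
immersed, and its value at `∞` is left to the one-point compactification. -/
noncomputable def polynomialCurve {n : ℕ} (p : Fin n → Polynomial ℝ) (t : ℝ) : Euc n :=
  WithLp.toLp 2 fun i => (p i).eval t

theorem continuous_polynomialCurve {n : ℕ} (p : Fin n → Polynomial ℝ) :
    Continuous (polynomialCurve p) :=
  (PiLp.continuous_toLp 2 _).comp (continuous_pi fun i => (p i).continuous)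

theorem inner_polynomialCurve {n : ℕ} (p : Fin n → Polynomial ℝ) (v : Euc n) (t : ℝ) :
    inner ℝ v (polynomialCurve p t) = (∑ j, Polynomial.C (v j) * p j).eval t := by
  simp [polynomialCurve, PiLp.inner_apply, Polynomial.eval_finsetSum, mul_comm]

theorem ClosesBySegment.superbridgeNumber_le {α : TopologicalKnot 3} {p : Fin 3 → Polynomial ℝ}
    {a b : ℝ} (h : ClosesBySegment (polynomialCurve p) a b)
    (hα : ∀ x, α.toMap x = OnePoint.map (polynomialCurve p) x) {m : ℕ} (hm : 1 ≤ m)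
    (hdeg : ∀ j, (p j).natDegree ≤ 2 * m) (hab : a < b) : superbridgeNumber α ≤ m := by
  obtain ⟨g, c, hg, hc, hgc⟩ := h
  have hmap : ∀ x, (α.map g).toMap x = (c x : OnePoint (Euc 3)) := fun x =>
    (congrArg g (hα x)).trans (hgc x)
  obtain ⟨K, hK⟩ := TopologicalKnot.exists_toTopologicalKnot_eq (α := α.map g) fun x => by
    simp [hmap]
  have hKc : ⇑K.toMap = c := funext fun x => OnePoint.coe_injective <| by
    rw [← hmap, ← hK]
    rfl
  refine ((superbridgeNumber_le_map α hg).trans (hK ▸ K.superbridgeNumber_le)).trans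
    (iSup₂_le fun v _ => ?_)
  have hclosed := hc.comp (innerₛₗ ℝ v).toAffineMap
  have hP : (innerₛₗ ℝ v).toAffineMap ∘ polynomialCurve p =
      fun t => (∑ j, Polynomial.C (v j) * p j).eval t := funext (inner_polynomialCurve p v)
  rw [← hKc, hP] at hclosed
  exact hclosed.encard_localMaxima_le ((innerSL ℝ v).continuous.comp K.toMap.continuous) hm
    (Polynomial.natDegree_sum_le_of_forall_le _ _
      fun j _ => (Polynomial.natDegree_C_mul_le _ _).trans (hdeg j)) hab

theorem exists_arc_of_strictAntiOn_of_strictMonoOn {f : ℝ → ℝ} (hf : Continuous f) {S T : ℝ}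
    (hS : StrictAntiOn f (Set.Iic S)) (hT : StrictMonoOn f (Set.Ici T))
    (hbot : Tendsto f atBot atTop) (htop : Tendsto f atTop atTop) (hST : S < T) :
    ∃ a b, a < b ∧ f a = f b ∧ (∀ t ∈ Set.Ioo a b, f t < f a) ∧
      StrictAntiOn f (Set.Iic a) ∧ StrictMonoOn f (Set.Ici b) := by
  obtain ⟨B, hB⟩ := isCompact_Icc.bddAbove_image (hf.continuousOn (s := Set.Icc S T))
  have hlt : ∀ t ∈ Set.Icc S T, f t < B + 1 := fun t ht => by
    linarith [hB (Set.mem_image_of_mem f ht)]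
  obtain ⟨a, ha, haB⟩ := isPreconnected_Iic.intermediate_value_Ici Set.self_mem_Iic
    (le_principal_iff.2 (Iic_mem_atBot S)) hf.continuousOn hbot
    (hlt S (Set.left_mem_Icc.2 hST.le)).le
  obtain ⟨b, hb, hbB⟩ := isPreconnected_Ici.intermediate_value_Ici Set.self_mem_Ici
    (le_principal_iff.2 (Ici_mem_atTop T)) hf.continuousOn htop
    (hlt T (Set.right_mem_Icc.2 hST.le)).le
  refine ⟨a, b, (Set.mem_Iic.1 ha).trans_lt (hST.trans_le hb), haB.trans hbB.symm,
    fun t ht => ?_, hS.mono (Set.Iic_subset_Iic.2 ha), hT.mono (Set.Ici_subset_Ici.2 hb)⟩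
  rcases le_total t S with htS | hSt
  · exact hS ha htS ht.1
  rcases le_total T t with hTt | htT
  · exact haB.trans hbB.symm ▸ hT hTt hb ht.2
  · exact haB ▸ hlt t ⟨hSt, htT⟩

section PolynomialTails

variable {q : Polynomial ℝ}

theorem exists_strictMonoOn_eval_Ici (hd : 0 < q.natDegree) (hl : 0 < q.leadingCoeff) :
    ∃ T : ℝ, StrictMonoOn (fun t => q.eval t) (Set.Ici T) := by
  have hl' : 0 < q.derivative.leadingCoeff := by
    rw [Polynomial.leadingCoeff, Polynomial.natDegree_derivative, Polynomial.coeff_derivative,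
      Nat.sub_add_cancel hd]
    exact mul_pos hl (by positivity)
  have hpos : ∀ᶠ t in atTop, 0 < q.derivative.eval t := by
    rcases Nat.eq_zero_or_pos q.derivative.natDegree with h | h
    · rw [Polynomial.eq_C_of_natDegree_eq_zero h] at hl' ⊢
      exact Eventually.of_forall fun t => by simpa using hl'
    · exact (Polynomial.tendsto_atTop_of_leadingCoeff_nonneg _
        (Polynomial.natDegree_pos_iff_degree_pos.1 h) hl'.le).eventually_gt_atTop 0
  obtain ⟨T, hT⟩ := eventually_atTop.1 hpos
  refine ⟨T, strictMonoOn_of_deriv_pos (convex_Ici T) q.continuous.continuousOn fun t ht => ?_⟩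
  rw [interior_Ici] at ht
  simpa only [q.deriv] using hT t (Set.mem_Ioi.1 ht).le

theorem exists_strictAntiOn_eval_Iic (hd : 0 < q.natDegree) (he : Even q.natDegree)
    (hl : 0 < q.leadingCoeff) : ∃ T : ℝ, StrictAntiOn (fun t => q.eval t) (Set.Iic T) := by
  obtain ⟨T, hT⟩ := exists_strictMonoOn_eval_Ici (q := q.comp (-Polynomial.X))
    (by simpa [Polynomial.natDegree_comp] using hd)
    (by simpa [he.neg_one_pow] using hl)
  refine ⟨-T, fun s hs t ht hst => ?_⟩
  simpa using hT (Set.mem_Ici.2 (le_neg.2 ht)) (Set.mem_Ici.2 (le_neg.2 hs)) (neg_lt_neg hst)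

theorem tendsto_eval_atBot_of_even (hd : 0 < q.natDegree) (he : Even q.natDegree)
    (hl : 0 < q.leadingCoeff) : Tendsto (fun t => q.eval t) atBot atTop := by
  have h := Polynomial.tendsto_atTop_of_leadingCoeff_nonneg (q.comp (-Polynomial.X))
    (by simpa [Polynomial.natDegree_pos_iff_degree_pos] using hd)
    (by simpa [he.neg_one_pow] using hl.le)
  simpa [Function.comp_def] using h.comp tendsto_neg_atBot_atTop

end PolynomialTails

theorem superbridgeNumber_le_of_natDegree_eq {α : TopologicalKnot 3} {p : Fin 3 → Polynomial ℝ}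
    (hα : ∀ x, α.toMap x = OnePoint.map (polynomialCurve p) x) {m : ℕ} (hm : 1 ≤ m)
    (hdeg : ∀ j, (p j).natDegree ≤ 2 * m) {i : Fin 3} (hi : (p i).natDegree = 2 * m) :
    superbridgeNumber α ≤ m := by
  have hinj : Function.Injective (polynomialCurve p) := fun s t hst =>
    OnePoint.coe_injective (α.injective (by simp [hα, hst]))
  have hs : (p i).leadingCoeff ≠ 0 := Polynomial.leadingCoeff_ne_zero.2 fun h => by
    simp [h] at hi
    omega
  set s := (p i).leadingCoeff
  have hd : 0 < (Polynomial.C s * p i).natDegree := by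
    rw [Polynomial.natDegree_C_mul hs]
    omega
  have he : Even (Polynomial.C s * p i).natDegree := by
    rw [Polynomial.natDegree_C_mul hs, hi]
    exact even_two_mul m
  have hl : 0 < (Polynomial.C s * p i).leadingCoeff := by
    rw [Polynomial.leadingCoeff_mul, Polynomial.leadingCoeff_C]
    exact mul_self_pos.2 hs
  obtain ⟨S, hS⟩ := exists_strictAntiOn_eval_Iic hd he hl
  obtain ⟨T, hT⟩ := exists_strictMonoOn_eval_Ici hd hl
  have hbot := tendsto_eval_atBot_of_even hd he hl
  have htop := Polynomial.tendsto_atTop_of_leadingCoeff_nonneg _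
    (Polynomial.natDegree_pos_iff_degree_pos.1 hd) hl.le
  obtain ⟨a, b, hab, hval, hlt, hanti, hmono⟩ := exists_arc_of_strictAntiOn_of_strictMonoOn
    (Polynomial.continuous _) (hS.mono (Set.Iic_subset_Iic.2 (min_le_left S (T - 1)))) hT hbot htop
    ((min_le_right _ _).trans_lt (sub_one_lt T))
  simp only [Polynomial.eval_mul, Polynomial.eval_C] at hval hlt hanti hmono hbot htop
  exact (closesBySegment_of_coord_lt (continuous_polynomialCurve p) hinj hs hab
    (mul_left_cancel₀ hs hval) hanti hmono hbot htop hlt).superbridgeNumber_le hα hm hdeg hab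

/-! ## Raising an odd degree -/

section OddDegree

variable {q : Polynomial ℝ}

theorem tendsto_eval_atBot_atBot_of_odd (ho : Odd q.natDegree) (hl : 0 < q.leadingCoeff) :
    Tendsto (fun t => q.eval t) atBot atBot := by
  have h := Polynomial.tendsto_atTop_of_leadingCoeff_nonneg (-q.comp (-Polynomial.X))
    (by simpa [Polynomial.natDegree_pos_iff_degree_pos] using
      Polynomial.natDegree_pos_iff_degree_pos.1 ho.pos)
    (by simpa [ho.neg_one_pow] using hl.le)
  simpa [Function.comp_def] using tendsto_neg_atTop_atBot.comp (h.comp tendsto_neg_atBot_atTop)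

theorem exists_forall_ge_eval_le_of_odd (ho : Odd q.natDegree) (hl : 0 < q.leadingCoeff) :
    ∃ T, ∀ t ≥ T, ∀ s ≤ t, q.eval s ≤ q.eval t := by
  obtain ⟨T, hT⟩ := exists_strictMonoOn_eval_Ici ho.pos hl
  obtain ⟨S, hS⟩ := eventually_atBot.1
    ((tendsto_eval_atBot_atBot_of_odd ho hl).eventually_le_atBot (q.eval T))
  obtain ⟨B, hB⟩ := isCompact_Icc.bddAbove_image (q.continuous.continuousOn (s := Set.Icc S T))
  have htop := Polynomial.tendsto_atTop_of_leadingCoeff_nonneg q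
    (Polynomial.natDegree_pos_iff_degree_pos.1 ho.pos) hl.le
  obtain ⟨R, hR⟩ := eventually_atTop.1 (htop.eventually_ge_atTop B)
  refine ⟨max R T, fun t ht s hst => ?_⟩
  have htT : t ∈ Set.Ici T := (le_max_right R T).trans ht
  rcases le_total T s with hTs | hsT
  · exact hT.monotoneOn hTs htT hst
  rcases le_total s S with hsS | hSs
  · exact (hS s hsS).trans (hT.monotoneOn Set.self_mem_Ici htT htT)
  · exact (hB (Set.mem_image_of_mem _ ⟨hSs, hsT⟩)).trans (hR t ((le_max_left R T).trans ht))

theorem exists_forall_abs_ge_eval_le_of_odd (ho : Odd q.natDegree) (hl : 0 < q.leadingCoeff) :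
    ∃ T, ∀ s t, s ≤ t → T ≤ |s| ∨ T ≤ |t| → q.eval s ≤ q.eval t := by
  obtain ⟨T, hT⟩ := exists_forall_ge_eval_le_of_odd ho hl
  obtain ⟨S, hS⟩ := exists_forall_ge_eval_le_of_odd (q := -q.comp (-Polynomial.X))
    (by simpa [Polynomial.natDegree_comp] using ho) (by simpa [ho.neg_one_pow] using hl)
  simp only [Polynomial.eval_neg, Polynomial.eval_comp, Polynomial.eval_X, neg_le_neg_iff] at hS
  refine ⟨max T S, fun s t hst h => ?_⟩
  have htails : T ≤ t ∨ s ≤ -S := by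
    simp only [max_le_iff, le_abs] at h
    grind
  rcases htails with ht | hs
  · exact hT t ht s hst
  · simpa using hS (-s) (le_neg.2 hs) (-t) (neg_le_neg hst)

theorem exists_mul_abs_sub_le_of_odd_of_leadingCoeff_pos (ho : Odd q.natDegree)
    (hl : 0 < q.leadingCoeff) :
    ∃ c T : ℝ, 0 < c ∧ ∀ t s, T ≤ |t| → c * |t - s| ≤ |q.eval t - q.eval s| := by
  set c := q.leadingCoeff / 2 with hc
  set y := q - Polynomial.C c * Polynomial.X with hy
  have hcoeff : 0 < y.coeff q.natDegree := by
    rw [hy, Polynomial.coeff_sub, Polynomial.coeff_C_mul, Polynomial.coeff_X,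
      Polynomial.coeff_natDegree]
    split_ifs <;> linarith
  have hdeg : y.natDegree = q.natDegree := by
    refine Polynomial.natDegree_eq_of_le_of_coeff_ne_zero ?_ hcoeff.ne'
    exact (Polynomial.natDegree_sub_le _ _).trans (max_le le_rfl
      ((Polynomial.natDegree_C_mul_le _ _).trans (Polynomial.natDegree_X_le.trans ho.pos)))
  obtain ⟨T, hT⟩ := exists_forall_abs_ge_eval_le_of_odd (q := y) (hdeg ▸ ho)
    (by rwa [Polynomial.leadingCoeff, hdeg])
  have hgrowth : ∀ s t, s ≤ t → T ≤ |s| ∨ T ≤ |t| → c * |t - s| ≤ |q.eval t - q.eval s| :=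
    fun s t hst h => by
      have hle := hT s t hst h
      simp only [hy, Polynomial.eval_sub, Polynomial.eval_mul, Polynomial.eval_C,
        Polynomial.eval_X] at hle
      rw [abs_of_nonneg (sub_nonneg.2 hst)]
      exact le_abs.2 (Or.inl (by linarith))
  refine ⟨c, T, half_pos hl, fun t s ht => ?_⟩
  rcases le_total s t with hst | hts
  · exact hgrowth s t hst (Or.inr ht)
  · rw [abs_sub_comm, abs_sub_comm (q.eval t)]
    exact hgrowth t s hts (Or.inl ht)

theorem exists_mul_abs_sub_le_of_odd (ho : Odd q.natDegree) :
    ∃ c T : ℝ, 0 < c ∧ ∀ t s, T ≤ |t| → c * |t - s| ≤ |q.eval t - q.eval s| := by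
  have hne : q.leadingCoeff ≠ 0 := Polynomial.leadingCoeff_ne_zero.2 fun h => by simp [h] at ho
  rcases hne.lt_or_gt with hl | hl
  · obtain ⟨c, T, hc, hT⟩ := exists_mul_abs_sub_le_of_odd_of_leadingCoeff_pos (q := -q)
      (by simpa using ho) (by simpa using hl)
    refine ⟨c, T, hc, fun t s ht => ?_⟩
    simpa [neg_add_eq_sub, abs_sub_comm] using hT t s ht
  · exact exists_mul_abs_sub_le_of_odd_of_leadingCoeff_pos ho hl

end OddDegree

theorem exists_continuous_differenceQuotient (p : Polynomial ℝ) :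
    ∃ Q : ℝ × ℝ → ℝ, Continuous Q ∧ (∀ t s, p.eval t - p.eval s = (t - s) * Q (t, s)) ∧
      ∀ t, Q (t, t) = p.derivative.eval t := by
  refine ⟨fun x => p.sum fun n a => a * ∑ k ∈ Finset.range n, x.1 ^ k * x.2 ^ (n - 1 - k), ?_,
    fun t s => ?_, fun t => ?_⟩
  · unfold Polynomial.sum
    fun_prop
  · simp only [Polynomial.eval_eq_sum, Polynomial.sum, ← Finset.sum_sub_distrib, Finset.mul_sum]
    refine Finset.sum_congr rfl fun n _ => ?_
    rw [← mul_sub, ← (Commute.all t s).geom_sum₂_mul, Finset.sum_mul, Finset.mul_sum]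
    exact Finset.sum_congr rfl fun k _ => by ring
  · simp only [geom_sum₂_self, Polynomial.derivative_eval, mul_assoc]

namespace PolynomialKnot

variable {n : ℕ} (κ : PolynomialKnot n)

theorem exists_mul_abs_sub_le_dist_of_isCompact {k : Set ℝ} (hk : IsCompact k) :
    ∃ δ > 0, ∀ t ∈ k, ∀ s ∈ k, δ * |t - s| ≤ dist (κ.toFun t) (κ.toFun s) := by
  choose Q hQcont hQ hQdiag using fun j => exists_continuous_differenceQuotient (κ.coord j)
  let q : ℝ × ℝ → Euc n := fun x => WithLp.toLp 2 fun j => Q j x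
  have hq : ∀ t s, κ.toFun t - κ.toFun s = (t - s) • q (t, s) := fun t s => by
    ext j
    exact hQ j t s
  have hq_ne : ∀ x, q x ≠ 0 := by
    rintro ⟨t, s⟩ h0
    rcases eq_or_ne t s with rfl | hts
    · obtain ⟨j, hj⟩ := κ.immersive t
      exact hj ((hQdiag j t).symm.trans (congrArg (fun x : Euc n => x j) h0))
    · exact hts (κ.toFun_injective (sub_eq_zero.1 (by rw [hq, h0, smul_zero])))
  have hq_cont : Continuous q := (PiLp.continuous_toLp 2 _).comp (continuous_pi hQcont)
  obtain ⟨δ, hδ, hle⟩ := (hk.prod hk).exists_forall_le' hq_cont.norm.continuousOn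
    fun x _ => norm_pos_iff.2 (hq_ne x)
  refine ⟨δ, hδ, fun t ht s hs => ?_⟩
  rw [dist_eq_norm, hq, norm_smul, Real.norm_eq_abs, mul_comm]
  exact mul_le_mul_of_nonneg_left (hle (t, s) ⟨ht, hs⟩) (abs_nonneg _)

theorem exists_antilipschitzWith_of_odd {i : Fin n} (ho : Odd (κ.coord i).natDegree) :
    ∃ K, AntilipschitzWith K κ.toFun := by
  obtain ⟨c, T, hc, hT⟩ := exists_mul_abs_sub_le_of_odd ho
  obtain ⟨δ, hδ, hle⟩ :=
    κ.exists_mul_abs_sub_le_dist_of_isCompact (isCompact_Icc (a := -T) (b := T))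
  have htail : ∀ t s, T ≤ |t| → c * |t - s| ≤ dist (κ.toFun t) (κ.toFun s) := fun t s ht =>
    (hT t s ht).trans (dist_eq_norm (κ.toFun t) (κ.toFun s) ▸
      PiLp.norm_apply_le (κ.toFun t - κ.toFun s) i)
  have hmin : ∀ t s, min c δ * |t - s| ≤ dist (κ.toFun t) (κ.toFun s) := fun t s => by
    have hminc := mul_le_mul_of_nonneg_right (min_le_left c δ) (abs_nonneg (t - s))
    rcases le_total T |t| with ht | ht
    · exact hminc.trans (htail t s ht)
    rcases le_total T |s| with hs | hs
    · rw [abs_sub_comm, dist_comm] at *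
      exact hminc.trans (htail s t hs)
    · exact (mul_le_mul_of_nonneg_right (min_le_right c δ) (abs_nonneg _)).trans
        (hle t (abs_le.1 ht) s (abs_le.1 hs))
  refine ⟨(min c δ).toNNReal⁻¹, AntilipschitzWith.of_le_mul_dist fun t s => ?_⟩
  rw [NNReal.coe_inv, Real.coe_toNNReal _ (lt_min hc hδ).le, ← div_eq_inv_mul,
    le_div_iff₀' (lt_min hc hδ)]
  exact hmin t s

end PolynomialKnot

theorem exists_lipschitzWith_leftInvOn {E : Type*} [PseudoMetricSpace E] {f : ℝ → E} {s : Set ℝ}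
    {K : NNReal} (hf : AntilipschitzWith K (s.domRestrict f)) :
    ∃ g : E → ℝ, LipschitzWith K g ∧ Set.LeftInvOn g f s := by
  have hinj : Set.InjOn f s := Set.injOn_iff_injective.2 hf.injective
  have hlip := hf.to_rightInvOn' (g := Function.invFunOn f s) (t := f '' s)
    (Set.forall_mem_image.2 fun t ht => Function.invFunOn_mem ⟨t, ht, rfl⟩)
    fun x hx => Function.invFunOn_eq hx
  obtain ⟨g, hg, hgeq⟩ := (lipschitzOnWith_iff_restrict.2 hlip).extend_real
  exact ⟨g, hg, fun t ht => (hgeq (Set.mem_image_of_mem f ht)).symm.trans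
    (hinj.leftInvOn_invFunOn ht)⟩

theorem exists_isOrientationPreserving_add_smul_of_lipschitzWith {E : Type*}
    [NormedAddCommGroup E] [NormedSpace ℝ E] [ProperSpace E] {e : E} {φ : E → ℝ}
    (hφ : Continuous φ) {K : NNReal} (hK : K < 1)
    (hlip : ∀ x, LipschitzWith K fun r : ℝ => φ (x + r • e)) (ℓ : E →L[ℝ] ℝ) (hℓ : ℓ e = 1) :
    ∃ g : OnePoint E ≃ₜ OnePoint E, IsOrientationPreserving g ∧ g OnePoint.infty = OnePoint.infty ∧
      ∀ x : E, g x = (x + φ x • e : E) := by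
  refine exists_isOrientationPreserving_add_smul hφ (fun x => ⟨K, hK, hlip x⟩) fun R => ?_
  set R₀ := R + ‖ℓ‖ * R * ‖e‖
  obtain ⟨B, hB⟩ := (isCompact_closedBall (0 : E) R₀).exists_bound_of_continuousOn hφ.continuousOn
  have hK' : 0 < 1 - (K : ℝ) := sub_pos.2 (mod_cast hK)
  refine ⟨R₀ + (‖ℓ‖ * R + B) / (1 - K) * ‖e‖, fun s x hx => ?_⟩
  set y := x + (s * φ x) • e with hy
  have hℓy : |ℓ y| ≤ ‖ℓ‖ * R := ℓ.le_opNorm_of_le hx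
  have hfoot : ‖x - ℓ x • e‖ ≤ R₀ := calc
    ‖x - ℓ x • e‖ = ‖y - ℓ y • e‖ := by
      congr 1
      simp only [hy, map_add, map_smul, hℓ, smul_eq_mul, mul_one, add_smul]
      abel
    _ ≤ ‖y‖ + |ℓ y| * ‖e‖ := (norm_sub_le _ _).trans_eq (by rw [norm_smul, Real.norm_eq_abs])
    _ ≤ R₀ := add_le_add hx (mul_le_mul_of_nonneg_right hℓy (norm_nonneg e))
  have hφx : |φ x| ≤ K * |ℓ x| + B := by
    have hdist := (hlip (x - ℓ x • e)).dist_le_mul (ℓ x) 0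
    simp only [sub_add_cancel, zero_smul, add_zero, Real.dist_eq, sub_zero] at hdist
    have hφfoot := hB _ (mem_closedBall_zero_iff.2 hfoot)
    rw [Real.norm_eq_abs] at hφfoot
    linarith [abs_sub_abs_le_abs_sub (φ x) (φ (x - ℓ x • e))]
  have hℓx : |ℓ x| ≤ (‖ℓ‖ * R + B) / (1 - K) := by
    have hmove : |s * φ x| ≤ |φ x| := by
      rw [abs_mul, abs_of_nonneg s.2.1]
      exact mul_le_of_le_one_left (abs_nonneg _) s.2.2
    have hxy : ℓ x = ℓ y - s * φ x := by simp [hy, hℓ]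
    rw [le_div_iff₀ hK']
    linarith [hxy ▸ abs_sub (ℓ y) (s * φ x)]
  calc ‖x‖ = ‖(x - ℓ x • e) + ℓ x • e‖ := by rw [sub_add_cancel]
    _ ≤ R₀ + (‖ℓ‖ * R + B) / (1 - K) * ‖e‖ := (norm_add_le _ _).trans (add_le_add hfoot
        (norm_smul (ℓ x) e ▸ mul_le_mul_of_nonneg_right hℓx (norm_nonneg e)))

namespace PolynomialKnot

variable {n : ℕ} (κ : PolynomialKnot n)

theorem exists_lipschitzWith_leftInverse_of_odd {i : Fin n} (ho : Odd (κ.coord i).natDegree) :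
    ∃ (σ : Euc n → ℝ) (ρ : ℝ → ℝ) (L Z : NNReal), LipschitzWith L σ ∧ Continuous ρ ∧
      (∀ t, σ (κ.toFun t) = t) ∧ ∀ t, Z < |(κ.coord i).eval t| → ρ ((κ.coord i).eval t) = t := by
  obtain ⟨c, T, hc, hT⟩ := exists_mul_abs_sub_le_of_odd ho
  obtain ⟨L, hL⟩ := κ.exists_antilipschitzWith_of_odd ho
  obtain ⟨σ, hσ, hσκ⟩ := exists_lipschitzWith_leftInvOn (hL.domRestrict Set.univ)
  obtain ⟨ρ, hρ, hρκ⟩ := exists_lipschitzWith_leftInvOn (f := fun t => (κ.coord i).eval t)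
    (s := {t | T ≤ |t|}) (K := c.toNNReal⁻¹) <| AntilipschitzWith.of_le_mul_dist fun t s => by
      rw [NNReal.coe_inv, Real.coe_toNNReal _ hc.le, ← div_eq_inv_mul, le_div_iff₀' hc]
      exact hT t s t.2
  obtain ⟨Z, hZ⟩ := (isCompact_Icc (a := -T) (b := T)).exists_bound_of_continuousOn
    (κ.coord i).continuous.continuousOn
  refine ⟨σ, ρ, L, ‖Z‖₊, hσ, hρ.continuous, fun t => hσκ (Set.mem_univ t), fun t ht => hρκ ?_⟩
  by_contra hlt
  exact ht.not_ge ((hZ t (abs_le.1 (not_le.1 hlt).le)).trans (Real.le_norm_self Z))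

theorem exists_continuous_eq_mul_eval_of_odd {i : Fin n} (ho : Odd (κ.coord i).natDegree) :
    ∃ (φ : Euc n → ℝ) (K : NNReal), Continuous φ ∧
      (∀ e : Euc n, e i = 0 → ‖e‖ = 1 → ∀ x, LipschitzWith K fun r : ℝ => φ (x + r • e)) ∧
      ∀ t, φ (κ.toFun t) = t * (κ.coord i).eval t := by
  obtain ⟨σ, ρ, L, Z, hσ, hρ, hσκ, hρκ⟩ := κ.exists_lipschitzWith_leftInverse_of_odd ho
  let clamp : ℝ → ℝ := fun y => max (-Z) (min y Z)
  have hclamp : ∀ y, |clamp y| ≤ Z := fun y =>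
    abs_le.2 ⟨le_max_left _ _, max_le (neg_le_self Z.2) (min_le_right _ _)⟩
  -- At the points of the knot where clamping matters, the factor `σ x - ρ (x i)` vanishes.
  refine ⟨fun x => x i * ρ (x i) + clamp (x i) * (σ x - ρ (x i)), Z * L,
    by have := hσ.continuous; fun_prop, fun e hei he x => ?_, fun t => ?_⟩
  · refine LipschitzWith.of_dist_le_mul fun r s => ?_
    have hσrs : dist (σ (x + r • e)) (σ (x + s • e)) ≤ L * dist r s := by
      refine (hσ.dist_le_mul _ _).trans_eq ?_
      rw [dist_add_left, dist_eq_norm, ← sub_smul, norm_smul, he, mul_one, dist_eq_norm]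
    calc dist _ _ = |clamp (x i)| * dist (σ (x + r • e)) (σ (x + s • e)) := by
          simp only [PiLp.add_apply, PiLp.smul_apply, hei, smul_zero, add_zero, Real.dist_eq,
            ← abs_mul]
          congr 1
          ring
      _ ≤ Z * (L * dist r s) := mul_le_mul (hclamp _) hσrs dist_nonneg Z.2
      _ = (Z * L : NNReal) * dist r s := by rw [NNReal.coe_mul, mul_assoc]
  · change (κ.coord i).eval t * ρ ((κ.coord i).eval t) +
      clamp ((κ.coord i).eval t) * (σ (κ.toFun t) - ρ ((κ.coord i).eval t)) = _
    rw [hσκ]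
    rcases lt_or_ge (Z : ℝ) |(κ.coord i).eval t| with ht | ht
    · rw [hρκ t ht]
      ring
    · simp only [clamp, min_eq_left (abs_le.1 ht).2, max_eq_right (abs_le.1 ht).1]
      ring

theorem exists_isOrientationPreserving_add_mul_eval_of_odd {i j : Fin n} (hij : i ≠ j)
    (ho : Odd (κ.coord i).natDegree) :
    ∃ (ε : ℝ) (g : OnePoint (Euc n) ≃ₜ OnePoint (Euc n)), ε ≠ 0 ∧ IsOrientationPreserving g ∧
      g OnePoint.infty = OnePoint.infty ∧ ∀ t : ℝ, g (κ.toFun t) =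
        (κ.toFun t + (ε * (t * (κ.coord i).eval t)) • EuclideanSpace.single j (1 : ℝ) : Euc n) := by
  obtain ⟨φ, K, hφ, hlip, hφκ⟩ := κ.exists_continuous_eq_mul_eval_of_odd ho
  obtain ⟨ε, hε, hKε⟩ := exists_pos_mul_lt one_pos (K : ℝ)
  have hlipε : ∀ x, LipschitzWith (‖ε‖₊ * K)
      fun r : ℝ => ε * φ (x + r • EuclideanSpace.single j (1 : ℝ)) := fun x =>
    (lipschitzWith_smul ε).comp (hlip _ (by simp [hij]) (by simp) x)
  have hlt : ‖ε‖₊ * K < 1 := by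
    rw [← NNReal.coe_lt_coe, NNReal.coe_mul, coe_nnnorm, Real.norm_of_nonneg hε.le, mul_comm]
    exact hKε
  obtain ⟨g, hg, hginf, hgx⟩ := exists_isOrientationPreserving_add_smul_of_lipschitzWith
    (φ := fun x => ε * φ x) (by fun_prop) hlt hlipε (EuclideanSpace.proj j) (by simp)
  exact ⟨ε, g, hε.ne', hg, hginf, fun t => by rw [hgx, hφκ]⟩

theorem superbridgeNumber_completion_le_of_odd (κ : PolynomialKnot 3) {m : ℕ}
    (hdeg : ∀ j, (κ.coord j).natDegree ≤ 2 * m + 1) {i : Fin 3}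
    (hi : (κ.coord i).natDegree = 2 * m + 1) :
    superbridgeNumber κ.completion ≤ (m + 1 : ℕ) := by
  obtain ⟨j, hji⟩ := exists_ne i
  obtain ⟨ε, g, hε, hg, hginf, hgκ⟩ :=
    κ.exists_isOrientationPreserving_add_mul_eval_of_odd hji.symm ⟨m, hi⟩
  set q := Polynomial.C ε * (Polynomial.X * κ.coord i) with hq
  have hqdeg : q.natDegree = 2 * (m + 1) := by
    have hne : κ.coord i ≠ 0 := fun h => by simp [h] at hi
    rw [hq, Polynomial.natDegree_C_mul hε, Polynomial.natDegree_X_mul hne, hi]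
    ring
  have hgp : ∀ x, (κ.completion.map g).toMap x =
      OnePoint.map (polynomialCurve (Function.update κ.coord j (κ.coord j + q))) x := by
    refine OnePoint.rec hginf fun t => (hgκ t).trans (congrArg _ ?_)
    ext k
    by_cases hk : k = j
    · subst hk
      simp [hq, toFun, polynomialCurve]
    · simp [hk, toFun, polynomialCurve]
  have hjdeg : (κ.coord j + q).natDegree = 2 * (m + 1) := by
    have hj := hdeg j
    rw [Polynomial.natDegree_add_eq_right_of_natDegree_lt (by omega), hqdeg]
  refine (superbridgeNumber_le_map κ.completion hg).trans
    (superbridgeNumber_le_of_natDegree_eq hgp (Nat.le_add_left 1 m) (fun k => ?_) (i := j) ?_)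
  · rcases eq_or_ne k j with rfl | hk
    · rw [Function.update_self, hjdeg]
    · rw [Function.update_of_ne hk]
      exact (hdeg k).trans (by omega)
  · rw [Function.update_self, hjdeg]

theorem degree_pos : 0 < κ.degree := by
  obtain ⟨i, hi⟩ := κ.immersive 0
  refine lt_of_lt_of_le (Nat.pos_of_ne_zero fun h => hi ?_)
    (Finset.le_sup (f := fun i => (κ.coord i).natDegree) (Finset.mem_univ i))
  rw [Polynomial.derivative_of_natDegree_zero h, Polynomial.eval_zero]

theorem superbridgeNumber_completion_le (κ : PolynomialKnot 3) :
    superbridgeNumber κ.completion ≤ ((κ.degree + 1) / 2 : ℕ) := by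
  obtain ⟨i, -, hi⟩ := Finset.exists_mem_eq_sup (Finset.univ : Finset (Fin 3))
    Finset.univ_nonempty fun i => (κ.coord i).natDegree
  have hle : ∀ j, (κ.coord j).natDegree ≤ κ.degree := fun j =>
    Finset.le_sup (f := fun i => (κ.coord i).natDegree) (Finset.mem_univ j)
  have hpos := κ.degree_pos
  rcases Nat.even_or_odd' κ.degree with ⟨m, hm | hm⟩
  · rw [show (κ.degree + 1) / 2 = m by omega]
    exact superbridgeNumber_le_of_natDegree_eq (p := κ.coord) (fun _ => rfl) (by omega)
      (fun j => hm ▸ hle j) (hi.symm.trans hm)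
  · rw [show (κ.degree + 1) / 2 = m + 1 by omega]
    exact κ.superbridgeNumber_completion_le_of_odd (fun j => hm ▸ hle j) (hi.symm.trans hm)

end PolynomialKnot

/-- A polynomial knot of degree `d` with superbridge number `s` (that of its one point
compactification) satisfies `s ≤ (1/2)(d+1)`; in particular its superbridge number is finite. -/
theorem mainTheorem8 (κ : PolynomialKnot 3) (d : ℕ) (hd : κ.degree = d) :
    ∃ s : ℕ, superbridgeNumber κ.completion = (s : ℕ∞) ∧ (s : ℝ) ≤ (1 / 2) * ((d : ℝ) + 1) := by
  have hle := hd ▸ κ.superbridgeNumber_completion_le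
  obtain ⟨s, hs⟩ := ENat.ne_top_iff_exists.1 (ne_top_of_le_ne_top (ENat.natCast_ne_top _) hle)
  refine ⟨s, hs.symm, ?_⟩
  rw [← hs, Nat.cast_le] at hle
  have hle' : (2 : ℝ) * s ≤ d + 1 := by exact_mod_cast (by omega : 2 * s ≤ d + 1)
  linarith
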